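/- Let $d\ge 1$ and let $(p(i,j))_{i,j\in\mathbb Z^d}$ be a stochastic matrix which is homogeneous ($p(i,j)=p(0,j-i)=:p(j-i)$), centered ($\sum_j j\,p(j)=0$), of finite range ($p(j)=0$ for all $|j|>v$, for some $v$), and truly $d$-dimensional ($\{j: p(j)\ne 0\}$ generates the group $\mathbb Z^d$). Let $(\varepsilon_n(i))_{n\ge 0,\, i\in\mathbb Z^d}$ be i.i.d. integrable symmetric real random variables with common law $F$, and define the wall process by $W_0(i)=0$ and $$W_n(i)=\max\Big(\sum_{j\in\mathbb Z^d}p(i,j)W_{n-1}(j)+\varepsilon_n(i),\,0\Big),\qquad n\ge 1,\ i\in\mathbb Z^d,$$ and $\mu_n=\mathbb E\,W_n(0)$. For $\gamma>1$ and $n\ge 2$ let $\ell_n(\gamma)$ be the unique positive solution $x$ of $x^\gamma\log x=\log n$, and let $L_n(\gamma)=(\log n)/\ell_n(\gamma)$. Suppose that $F$ belongs to $\mathcal L_\alpha^-$ for some $\alpha\ge 1$, that is, there are constants $c,c'>0$ such that $F((x,\infty))\le c\,e^{-c'x^\alpha}$ for all $x>0$. Then $W_n(0)$ is integrable for all $n\ge2$,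 and the following bounds hold. If $d\ge 3$, there is a constant $c_3>0$, depending only on $d$, $\alpha$, the matrix $p$ and the tail constants $c,c'$, such that for all $n\ge 2$: (i) if $\alpha\ne 1+\frac d2$, then $\mu_n\le c_3(\log n)^{\max\left(\frac1\alpha,\frac{2}{2+d}\right)}$; (ii) if $\alpha=1+\frac d2$, then $\mu_n\le c_3\,L_n\big(1+\tfrac2d\big)$. If $d=2$, there is a constant $c_3>0$, depending only on $\alpha$, the matrix $p$ and $c,c'$, such that $\mu_n\le c_3\log n$ for all $n\ge 2$. -/

import Mathlib

open MeasureTheory ProbabilityTheory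

/-- The standing assumptions on the matrix `p(i,j)`, `i, j ∈ ℤ^d`: stochastic, homogeneous,
centered, of finite range, and truly `d`-dimensional. -/
structure IsHarnessMatrix {d : ℕ} (p : (Fin d → ℤ) → (Fin d → ℤ) → ℝ) : Prop where
  nonneg : ∀ i j, 0 ≤ p i j
  sum_one : ∀ i, HasSum (fun j => p i j) 1
  homogeneous : ∀ i j, p i j = p 0 (j - i)
  mean_zero : ∀ k : Fin d, HasSum (fun j : Fin d → ℤ => p 0 j * (j k : ℝ)) 0
  finite_range : ∃ v : ℝ, ∀ j : Fin d → ℤ, v < ‖j‖ → p 0 j = 0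
  generates : AddSubgroup.closure {j : Fin d → ℤ | p 0 j ≠ 0} = ⊤

/-- The wall process driven by the noise values `e n i`:
`W_0 = 0` and `W_n(i) = (∑_j p(i,j) W_{n-1}(j) + e_n(i))^+` for `n ≥ 1`. -/
noncomputable def wall {d : ℕ} (p : (Fin d → ℤ) → (Fin d → ℤ) → ℝ)
    (e : ℕ → (Fin d → ℤ) → ℝ) : ℕ → (Fin d → ℤ) → ℝ
  | 0 => fun _ => 0
  | n + 1 => fun i => max ((∑' j, p i j * wall p e n j) + e (n + 1) i) 0

/-- The variables `ε_n(i)` are i.i.d. with law `F`, integrable and symmetric. -/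
structure IsNoise {d : ℕ} {Ω : Type*} [MeasurableSpace Ω] (P : Measure Ω)
    (ε : ℕ → (Fin d → ℤ) → Ω → ℝ) (F : Measure ℝ) : Prop where
  measurable : ∀ n i, Measurable (ε n i)
  law : ∀ n i, P.map (ε n i) = F
  indep : iIndepFun (fun q : ℕ × (Fin d → ℤ) => ε q.1 q.2) P
  integrable : Integrable (fun x : ℝ => x) F
  symmetric : F.map (fun x : ℝ => -x) = F

/-- `F` lies in the class `𝓛_α^-`, with tail constants `c` and `c'`:
`F(x, ∞) ≤ c exp(-c' x^α)` for all `x > 0`. -/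
def HasExpTail (α c c' : ℝ) (F : Measure ℝ) : Prop :=
  ∀ x : ℝ, 0 < x → F (Set.Ioi x) ≤ ENNReal.ofReal (c * Real.exp (-c' * x ^ α))

/-- The height `W_n(0)` of the wall process at the origin, as a random variable. -/
noncomputable def wallAtZero {d : ℕ} {Ω : Type*} (p : (Fin d → ℤ) → (Fin d → ℤ) → ℝ)
    (ε : ℕ → (Fin d → ℤ) → Ω → ℝ) (n : ℕ) (ω : Ω) : ℝ :=
  wall p (fun m j => ε m j ω) n 0

/-- The mean height `μ_n = 𝔼 W_n(0)`. -/
noncomputable def wallMean {d : ℕ} {Ω : Type*} [MeasurableSpace Ω] (P : Measure Ω)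
    (p : (Fin d → ℤ) → (Fin d → ℤ) → ℝ) (ε : ℕ → (Fin d → ℤ) → Ω → ℝ) (n : ℕ) : ℝ :=
  ∫ ω, wallAtZero p ε n ω ∂P

/-- The equation defining `ℓ_n(γ)` has exactly one positive solution. -/
theorem existsUnique_ell {γ : ℝ} (hγ : 1 < γ) {n : ℕ} (hn : 1 ≤ n) :
    ∃! x : ℝ, 0 < x ∧ x ^ γ * Real.log x = Real.log n := by
  have hn' : (1 : ℝ) ≤ n := by exact_mod_cast hn
  have hlog : 0 ≤ Real.log n := Real.log_nonneg hn'
  have hcont : ContinuousOn (fun x : ℝ => x ^ γ * Real.log x) (Set.Icc 1 (n : ℝ)) := by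
    apply ContinuousOn.mul
    · exact continuousOn_id.rpow_const fun x _ => Or.inr (by linarith)
    · exact Real.continuousOn_log.mono fun x hx => by
        have := hx.1
        simp only [Set.mem_compl_iff, Set.mem_singleton_iff]
        intro h
        linarith
  have hmem : Real.log n ∈ Set.Icc ((1 : ℝ) ^ γ * Real.log 1) ((n : ℝ) ^ γ * Real.log n) := by
    refine ⟨by simpa using hlog, ?_⟩
    exact le_mul_of_one_le_left hlog (Real.one_le_rpow hn' (by linarith))
  obtain ⟨x, hx, hxe⟩ := intermediate_value_Icc hn' hcont hmem
  have hge : ∀ y : ℝ, 0 < y → y ^ γ * Real.log y = Real.log n → 1 ≤ y := by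
    intro y hy hye
    by_contra hlt
    have h1 : Real.log y < 0 := Real.log_neg hy (not_le.mp hlt)
    have h2 : 0 < y ^ γ := Real.rpow_pos_of_pos hy γ
    have := mul_neg_of_pos_of_neg h2 h1
    linarith
  have hmono : ∀ y z : ℝ, 1 ≤ y → y < z → y ^ γ * Real.log y < z ^ γ * Real.log z := by
    intro y z hy hyz
    have h1 : Real.log y < Real.log z := Real.log_lt_log (by linarith) hyz
    have h2 : y ^ γ ≤ z ^ γ := Real.rpow_le_rpow (by linarith) hyz.le (by linarith)
    have h3 : 0 < z ^ γ := Real.rpow_pos_of_pos (by linarith) γ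
    have h4 : 0 ≤ Real.log y := Real.log_nonneg hy
    calc y ^ γ * Real.log y ≤ z ^ γ * Real.log y := mul_le_mul_of_nonneg_right h2 h4
      _ < z ^ γ * Real.log z := mul_lt_mul_of_pos_left h1 h3
  refine ⟨x, ⟨by linarith [hx.1], hxe⟩, ?_⟩
  rintro y ⟨hy, hye⟩
  have hy1 := hge y hy hye
  rcases lt_trichotomy y x with h | h | h
  · have := hmono y x hy1 h
    simp only at hxe
    linarith
  · exact h
  · have := hmono x y hx.1 h
    simp only at hxe
    linarith

open Classical in
/-- `ℓ_n(γ)`: the positive solution `x` of `x^γ log x = log n` (unique for `γ > 1`, `n ≥ 1`). -/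
noncomputable def ell (n : ℕ) (γ : ℝ) : ℝ :=
  if h : ∃ x : ℝ, 0 < x ∧ x ^ γ * Real.log x = Real.log n then h.choose else 0

theorem ell_spec {γ : ℝ} (hγ : 1 < γ) {n : ℕ} (hn : 1 ≤ n) :
    0 < ell n γ ∧ ell n γ ^ γ * Real.log (ell n γ) = Real.log n := by
  have h := (existsUnique_ell hγ hn).exists
  rw [ell, dif_pos h]
  exact h.choose_spec

/-- `L_n(γ) = (log n) / ℓ_n(γ)`. -/
noncomputable def bigL (n : ℕ) (γ : ℝ) : ℝ := Real.log n / ell n γ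

/-! Let `Z` be the process without wall (`harness`): `Z_n = ∑_{k<n} P^k ε_{n-k}`, a centered linear
function of the noise. Lifting `Z` by the depth `a` it reaches in the backward cone of `(n, 0)`
dominates the wall process there, so `W_n(0) ≤ Z_n(0) + a` (`wall_le_harness_add`). Since `𝔼 Z_n(0)
= 0`, `μ_n` is at most the mean of a maximum of `-Z` over about `n^(d+1)` space-time points. The
exponential Chebyshev bound gives `μ_n ≤ C (log n + Λ(t) + 1) / t` for admissible `t > 0`, where
`Λ(t)` bounds the log-moment generating functions of `-Z_m(i)` at `t` (`wallMean_le`).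

By independence `Λ(t)` is a sum over `k, j` of log-moment generating functions of `F` at `s = t
p^k(j)`. Each is at most `C s · growth(s / s₀)`: quadratic near `0` by symmetry and, for `α > 1`, of
order `s^(α/(α-1))` at infinity by the tail (`exists_integral_exp_le_exp_growth`). With `∑_j p^k(j)
= 1` and the heat kernel bound `p^k(j) ≤ C (k+1)^(-d/2)`, this yields `Λ(t) ≤ C t ∑_k growth(A t
(k+1)^(-d/2))` (`exists_wallMean_le`).

The heat kernel bound comes from a comparison of measures: the support of the step law contains `d +
1` affinely independent points, so its `d`-fold convolution dominates `δ` times a convolution of `d`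
fair coins in independent directions. The number of coin rounds is then binomial, and `m` rounds
have atoms of size at most `C m^(-d/2)`.

It remains to choose `t`. Put `r = d/2 > 1`, `β = 1/(α-1)`. If `βr > 1` the first terms dominate,
`Λ(t)` is of order `t^(1+β)`, and the exponent `1/α` results. If `βr < 1` the roughly `t^(1/r)`
terms with argument above `1` dominate, `Λ(t)` is of order `t^(1+1/r)`, and the exponent is
`2/(2+d)`. At `βr = 1` a logarithm appears and `t = ℓ_n(1+2/d)` is the balance. For `α = 1` or `d =
2` a small constant `t` suffices. -/

/-! ### Finite measures on a group as elements of the group algebra -/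

namespace AddMonoidAlgebra

/-- All coefficients are nonnegative. -/
def CoeffNonneg {M : Type*} (x : AddMonoidAlgebra ℝ M) : Prop := ∀ m, 0 ≤ x.coeff m

/-- The total mass, that is the sum of the coefficients, as an algebra homomorphism. -/
noncomputable def mass {M : Type*} [AddCommGroup M] : AddMonoidAlgebra ℝ M →ₐ[ℝ] ℝ :=
  AddMonoidAlgebra.lift ℝ ℝ M 1

theorem mass_eq_sum {M : Type*} [AddCommGroup M] (x : AddMonoidAlgebra ℝ M) :
    mass x = x.coeff.sum fun _ a => a := by
  simp [mass, AddMonoidAlgebra.lift_apply]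

theorem mass_single {M : Type*} [AddCommGroup M] (m : M) (a : ℝ) : mass (single m a) = a := by
  simp [mass]

variable {M : Type*} [AddCommGroup M] {x y : AddMonoidAlgebra ℝ M}

theorem CoeffNonneg.add (hx : CoeffNonneg x) (hy : CoeffNonneg y) : CoeffNonneg (x + y) :=
  fun m => by simpa using add_nonneg (hx m) (hy m)

theorem CoeffNonneg.mul (hx : CoeffNonneg x) (hy : CoeffNonneg y) : CoeffNonneg (x * y) := by
  intro m
  rw [coeff_mul_apply_left]
  exact Finset.sum_nonneg fun h _ => mul_nonneg (hx h) (hy _)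

theorem coeffNonneg_single {M : Type*} (m : M) {a : ℝ} (ha : 0 ≤ a) : CoeffNonneg (single m a) := by
  classical
  intro k
  rw [coeff_single, Finsupp.single_apply]
  split_ifs <;> simp [ha]

theorem coeffNonneg_one : CoeffNonneg (1 : AddMonoidAlgebra ℝ M) :=
  coeffNonneg_single 0 zero_le_one

theorem CoeffNonneg.pow (hx : CoeffNonneg x) (n : ℕ) : CoeffNonneg (x ^ n) := by
  induction n with
  | zero => simpa using coeffNonneg_one
  | succ n ih => rw [pow_succ]; exact ih.mul hx

/-- Convolution with a positive measure is a weighted average of translates, so it raises the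
supremum at most by the factor of its mass. -/
theorem coeff_mul_le (hx : CoeffNonneg x) {b : ℝ} (hy : ∀ m, y.coeff m ≤ b) (m : M) :
    (x * y).coeff m ≤ mass x * b := by
  rw [coeff_mul_apply_left, mass_eq_sum, Finsupp.sum, Finsupp.sum, Finset.sum_mul]
  exact Finset.sum_le_sum fun h _ => mul_le_mul_of_nonneg_left (hy _) (hx h)

/-- Convolution is monotone for the coefficientwise order on positive elements. Positivity of the
smaller product is carried along because the induction step uses it. -/
theorem CoeffNonneg.prod_add_sub_prod {ι : Type*} (s : Finset ι) (u r : ι → AddMonoidAlgebra ℝ M)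
    (hu : ∀ i, CoeffNonneg (u i)) (hr : ∀ i, CoeffNonneg (r i)) :
    CoeffNonneg (∏ i ∈ s, u i) ∧ CoeffNonneg (∏ i ∈ s, (u i + r i) - ∏ i ∈ s, u i) := by
  classical
  induction s using Finset.induction_on with
  | empty => exact ⟨by simpa using coeffNonneg_one, by intro m; simp⟩
  | insert i s hi ih =>
    rw [Finset.prod_insert hi, Finset.prod_insert hi]
    refine ⟨(hu i).mul ih.1, ?_⟩
    have h := ((hu i).mul ih.2).add ((hr i).mul (ih.2.add ih.1))
    convert h using 1
    ring

/-- If the vectors `v i` are independent, no coefficient of `∏ (1 + X^{v i})^m` exceeds the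
corresponding power of the central binomial coefficient. -/
theorem coeff_prod_one_add_single_pow_le {ι : Type*} [Fintype ι] (v : ι → M)
    (hv : Function.Injective fun β : ι → ℕ => ∑ i, β i • v i) (m : ℕ) (j : M) :
    ((∏ i, (1 + single (v i) (1 : ℝ)) ^ m : AddMonoidAlgebra ℝ M)).coeff j ≤
      (m.choose (m / 2) : ℝ) ^ Fintype.card ι := by
  classical
  have h1 : ∀ i, (1 + single (v i) (1 : ℝ)) ^ m =
      ∑ b ∈ Finset.range (m + 1), single (b • v i) (m.choose b : ℝ) := by
    intro i
    rw [add_comm, add_pow]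
    refine Finset.sum_congr rfl fun b _ => ?_
    rw [single_pow, one_pow, one_pow, mul_one, natCast_def, single_mul_single]
    simp
  simp_rw [h1]
  rw [Finset.prod_univ_sum]
  simp_rw [prod_single]
  rw [coeff_sum, Finsupp.finsetSum_apply]
  simp_rw [coeff_single, Finsupp.single_apply]
  by_cases hj : ∃ β : ι → ℕ, ∑ i, β i • v i = j
  · obtain ⟨β, rfl⟩ := hj
    have h2 : ∀ γ : ι → ℕ, (∑ i, γ i • v i = ∑ i, β i • v i) ↔ γ = β :=
      fun γ => ⟨fun h => hv h, fun h => by rw [h]⟩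
    simp_rw [h2]
    rw [Finset.sum_ite_eq']
    split_ifs
    · rw [← Finset.card_univ, ← Finset.prod_const]
      exact Finset.prod_le_prod (fun _ _ => by positivity)
        fun i _ => by exact_mod_cast Nat.choose_le_middle _ _
    · positivity
  · rw [Finset.sum_eq_zero]
    · positivity
    · intro γ _
      rw [if_neg fun h => hj ⟨γ, h⟩]

end AddMonoidAlgebra

/-! ### Binomial estimates -/

/-- The recursion for central binomial coefficients reduces the induction step to `(2n+1)(2n+3) ≤
4(n+1)^2`. This gives the order `n^(-1/2)` of the largest binomial atom without Stirling's formula.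
-/
theorem centralBinom_sq_mul_le (n : ℕ) : n.centralBinom ^ 2 * (2 * n + 1) ≤ 16 ^ n := by
  induction n with
  | zero => simp
  | succ n ih =>
    have h := Nat.succ_mul_centralBinom_succ n
    have h2 : (n + 1) ^ 2 * ((n + 1).centralBinom ^ 2 * (2 * (n + 1) + 1)) ≤
        (n + 1) ^ 2 * 16 ^ (n + 1) := by
      calc (n + 1) ^ 2 * ((n + 1).centralBinom ^ 2 * (2 * (n + 1) + 1))
          = ((n + 1) * (n + 1).centralBinom) ^ 2 * (2 * n + 3) := by ring
        _ = (n.centralBinom ^ 2 * (2 * n + 1)) * (4 * (2 * n + 1) * (2 * n + 3)) := by rw [h]; ring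
        _ ≤ 16 ^ n * (4 * (2 * n + 1) * (2 * n + 3)) := Nat.mul_le_mul_right _ ih
        _ ≤ 16 ^ n * (16 * (n + 1) ^ 2) := Nat.mul_le_mul_left _ (by nlinarith)
        _ = _ := by ring
    exact Nat.le_of_mul_le_mul_left h2 (by positivity)

theorem choose_half_sq_mul_le (m : ℕ) : (m.choose (m / 2)) ^ 2 * (m + 1) ≤ 2 * 4 ^ m := by
  rcases Nat.even_or_odd' m with ⟨n, rfl | rfl⟩
  · have h := centralBinom_sq_mul_le n
    rw [Nat.centralBinom_eq_two_mul_choose] at h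
    rw [Nat.mul_div_cancel_left _ two_pos, pow_mul]
    norm_num
    omega
  · have h := centralBinom_sq_mul_le (n + 1)
    have h2 : (2 * n + 1) / 2 = n := by omega
    have h3 : (n + 1).centralBinom = 2 * (2 * n + 1).choose n := by
      rw [Nat.centralBinom_eq_two_mul_choose, show 2 * (n + 1) = (2 * n + 1) + 1 by ring,
        Nat.choose_succ_succ, ← Nat.choose_symm_half]
      ring
    rw [h3] at h
    rw [h2]
    have h4 : (16 : ℕ) ^ (n + 1) = 4 * 4 ^ (2 * n + 1) := by
      rw [show (16 : ℕ) = 4 ^ 2 by norm_num, ← pow_mul, ← pow_succ']; ring_nf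
    rw [h4] at h
    nlinarith [sq_nonneg ((2 * n + 1).choose n)]

theorem choose_half_div_two_pow_le (m : ℕ) :
    (m.choose (m / 2) : ℝ) / 2 ^ m ≤ √2 * (√(m + 1))⁻¹ := by
  have h : ((m.choose (m / 2) : ℝ)) ^ 2 * (m + 1) ≤ 2 * 4 ^ m := by
    exact_mod_cast choose_half_sq_mul_le m
  rw [← Real.sqrt_inv, ← Real.sqrt_mul (by norm_num)]
  apply Real.le_sqrt_of_sq_le
  rw [div_pow, ← pow_mul, mul_comm m 2, pow_mul, ← div_eq_mul_inv, div_le_div_iff₀ (by positivity) (by positivity)]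
  norm_num
  exact h

/-- Negative moments of the binomial law. -/
theorem exists_sum_binomial_inv_pow_le {δ : ℝ} (hδ : 0 < δ) (hδ1 : δ ≤ 1) (D : ℕ) :
    ∃ C : ℝ, 0 < C ∧ ∀ k : ℕ, ∑ m ∈ Finset.range (k + 1),
      δ ^ m * (1 - δ) ^ (k - m) * (k.choose m) * ((m + 1 : ℝ) ^ D)⁻¹ ≤ C * ((k + 1 : ℝ) ^ D)⁻¹ := by
  induction D with
  | zero =>
    refine ⟨1, one_pos, fun k => ?_⟩
    have := add_pow δ (1 - δ) k
    simp at this ⊢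
    linarith
  | succ D ih =>
    obtain ⟨C, hC, h⟩ := ih
    refine ⟨2 ^ D / δ * C, by positivity, fun k => ?_⟩
    have hq : 0 ≤ 1 - δ := by linarith
    -- Since `choose k m / (m+1) = choose (k+1) (m+1) / (k+1)`, one more negative power is traded
    -- for the moment of order `D` at `k + 1`. The shifted weight costs `1/δ`, and `m + 2 ≤ 2(m+1)`
    -- costs `2 ^ D`.
    have h1 := h (k + 1)
    rw [Finset.sum_range_succ'] at h1
    have h2 : ∑ m ∈ Finset.range (k + 1), δ ^ (m + 1) * (1 - δ) ^ (k + 1 - (m + 1)) *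
        ((k + 1).choose (m + 1)) * (((m + 1 : ℕ) + 1 : ℝ) ^ D)⁻¹ ≤
        C * (((k + 1 : ℕ) + 1 : ℝ) ^ D)⁻¹ := by
      refine le_trans ?_ h1
      have : 0 ≤ δ ^ 0 * (1 - δ) ^ (k + 1 - 0) * ((k + 1).choose 0) * (((0 : ℕ) + 1 : ℝ) ^ D)⁻¹ := by
        positivity
      linarith
    calc _ ≤ ∑ m ∈ Finset.range (k + 1), 2 ^ D / (δ * (k + 1)) *
          (δ ^ (m + 1) * (1 - δ) ^ (k + 1 - (m + 1)) *
        ((k + 1).choose (m + 1)) * (((m + 1 : ℕ) + 1 : ℝ) ^ D)⁻¹) := by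
          refine Finset.sum_le_sum fun m hm => ?_
          have e1 : ((k + 1).choose (m + 1) : ℝ) = (k + 1) * k.choose m / (m + 1) := by
            rw [eq_div_iff (by positivity)]
            exact_mod_cast (Nat.add_one_mul_choose_eq k m).symm
          rw [e1, Nat.add_sub_add_right]
          have e2 : ((m + 1 : ℝ) ^ D)⁻¹ ≤ 2 ^ D * (((m + 1 : ℕ) + 1 : ℝ) ^ D)⁻¹ := by
            rw [← div_eq_mul_inv, inv_eq_one_div, div_le_div_iff₀ (by positivity) (by positivity),
              one_mul, ← mul_pow]
            push_cast
            exact pow_le_pow_left₀ (by positivity) (by linarith) _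
          calc δ ^ m * (1 - δ) ^ (k - m) * (k.choose m) * ((m + 1 : ℝ) ^ (D + 1))⁻¹
              = δ ^ m * (1 - δ) ^ (k - m) * (k.choose m) * (m + 1 : ℝ)⁻¹ * ((m + 1 : ℝ) ^ D)⁻¹ := by
                rw [pow_succ, mul_inv]; ring
            _ ≤ δ ^ m * (1 - δ) ^ (k - m) * (k.choose m) * (m + 1 : ℝ)⁻¹ *
                (2 ^ D * (((m + 1 : ℕ) + 1 : ℝ) ^ D)⁻¹) := by
                apply mul_le_mul_of_nonneg_left e2; positivity
            _ = _ := by field_simp; ring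
      _ = 2 ^ D / (δ * (k + 1)) * _ := (Finset.mul_sum _ _ _).symm
      _ ≤ 2 ^ D / (δ * (k + 1)) * (C * (((k + 1 : ℕ) + 1 : ℝ) ^ D)⁻¹) := by gcongr
      _ ≤ 2 ^ D / (δ * (k + 1)) * (C * ((k + 1 : ℝ) ^ D)⁻¹) := by
          gcongr; linarith
      _ = _ := by rw [pow_succ]; field_simp

/-- Half-integer moments follow from integer ones by the arithmetic-geometric mean inequality `f ≤ K
f² / 2 + 1 / (2K)`, with `K = (k+1)^(D/2)` making both terms of the same order. -/
theorem exists_sum_binomial_inv_sqrt_pow_le {δ : ℝ} (hδ : 0 < δ) (hδ1 : δ ≤ 1) (D : ℕ) :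
    ∃ C : ℝ, 0 < C ∧ ∀ k : ℕ, ∑ m ∈ Finset.range (k + 1),
      δ ^ m * (1 - δ) ^ (k - m) * (k.choose m) * ((√(m + 1))⁻¹) ^ D ≤
        C * ((√(k + 1))⁻¹) ^ D := by
  obtain ⟨C, hC, h⟩ := exists_sum_binomial_inv_pow_le hδ hδ1 D
  refine ⟨(C + 1) / 2, by positivity, fun k => ?_⟩
  have hq : 0 ≤ 1 - δ := by linarith
  set K : ℝ := (√(k + 1)) ^ D with hK
  have hKpos : 0 < K := by positivity
  have hK2 : ((k + 1 : ℝ) ^ D) = K ^ 2 := by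
    rw [hK, ← pow_mul, mul_comm, pow_mul, Real.sq_sqrt (by positivity)]
  have hone : ∑ m ∈ Finset.range (k + 1), δ ^ m * (1 - δ) ^ (k - m) * (k.choose m) = 1 := by
    rw [← add_pow]; simp
  calc _ ≤ ∑ m ∈ Finset.range (k + 1), (K / 2 *
          (δ ^ m * (1 - δ) ^ (k - m) * (k.choose m) * ((m + 1 : ℝ) ^ D)⁻¹) +
          1 / (2 * K) * (δ ^ m * (1 - δ) ^ (k - m) * (k.choose m))) := by
        refine Finset.sum_le_sum fun m _ => ?_
        set f : ℝ := ((√(m + 1))⁻¹) ^ D with hf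
        have hf2 : ((m + 1 : ℝ) ^ D)⁻¹ = f ^ 2 := by
          rw [hf, ← pow_mul, mul_comm D 2, pow_mul, inv_pow, Real.sq_sqrt (by positivity), inv_pow]
        have hfle : f ≤ K / 2 * f ^ 2 + 1 / (2 * K) := by
          have : K / 2 * f ^ 2 + 1 / (2 * K) - f = (K * f - 1) ^ 2 / (2 * K) := by field_simp; ring
          have : 0 ≤ (K * f - 1) ^ 2 / (2 * K) := by positivity
          linarith
        have hw : 0 ≤ δ ^ m * (1 - δ) ^ (k - m) * (k.choose m) := by positivity
        rw [hf2]
        nlinarith [mul_le_mul_of_nonneg_left hfle hw]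
    _ ≤ K / 2 * (C * (K ^ 2)⁻¹) + 1 / (2 * K) * 1 := by
        rw [Finset.sum_add_distrib, ← Finset.mul_sum, ← Finset.mul_sum, hone, ← hK2]
        gcongr
        exact h k
    _ = _ := by rw [inv_pow, ← hK]; field_simp

/-! ### Heat kernel upper bound -/

namespace AddMonoidAlgebra

/-- Heat kernel upper bound for a random walk whose step law charges `b` and the points `a i`, where
the differences `a i - b` are independent. -/
theorem exists_coeff_pow_le {M : Type*} [AddCommGroup M] (x : AddMonoidAlgebra ℝ M)
    (hx : CoeffNonneg x) (hmass : mass x = 1) {ι : Type*} [Fintype ι] [Nonempty ι] (a : ι → M) (b : M)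
    (ha : ∀ i, 0 < x.coeff (a i)) (hb : 0 < x.coeff b)
    (hinj : Function.Injective fun β : ι → ℕ => ∑ i, β i • (a i - b)) :
    ∃ C : ℝ, 0 < C ∧ ∀ (n : ℕ) (m : M), (x ^ n).coeff m ≤ C * ((√(n + 1))⁻¹) ^ Fintype.card ι := by
  classical
  set D := Fintype.card ι with hD
  have hDpos : 0 < D := Fintype.card_pos
  obtain ⟨c, hc, hca, hcb⟩ : ∃ c : ℝ, 0 < c ∧ (∀ i, c ≤ x.coeff (a i)) ∧ c ≤ x.coeff b := by
    obtain ⟨i₀, hi₀⟩ := Finite.exists_min fun i => x.coeff (a i)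
    exact ⟨min (x.coeff (a i₀)) (x.coeff b), lt_min (ha i₀) hb,
      fun i => (min_le_left _ _).trans (hi₀ i), min_le_right _ _⟩
  set w : ι → AddMonoidAlgebra ℝ M := fun i => single (a i) (1 / 2) + single b (1 / 2) with hw
  have hwn : ∀ i, CoeffNonneg (w i) := fun i =>
    (coeffNonneg_single _ (by norm_num)).add (coeffNonneg_single _ (by norm_num))
  have hwm : ∀ i, mass (w i) = 1 := fun i => by
    simp only [hw, map_add, mass_single]; norm_num
  have hcw : ∀ i, CoeffNonneg (c • w i) := fun i m => by
    simpa using mul_nonneg hc.le (hwn i m)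
  have hr : ∀ i, CoeffNonneg (x - c • w i) := by
    intro i m
    simp only [hw, coeff_sub, coeff_smul, coeff_add, coeff_single, Finsupp.sub_apply,
      Finsupp.smul_apply, Finsupp.add_apply, Finsupp.single_apply, smul_eq_mul]
    have h0 := hx m
    split_ifs with h1 h2 h2
    · subst h1; linarith [hca i]
    · subst h1; linarith [hca i]
    · subst h2; linarith
    · linarith
  -- Each `x` dominates `c • w i`, where `w i` is a fair coin between `a i` and `b`; hence `x ^ D`
  -- dominates `c ^ D` times the product of the coins.
  have hprod := (CoeffNonneg.prod_add_sub_prod Finset.univ (fun i => c • w i)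
    (fun i => x - c • w i) hcw hr).2
  simp only [add_sub_cancel, Finset.prod_const, Finset.card_univ, ← hD] at hprod
  set s : AddMonoidAlgebra ℝ M := ∏ i, w i with hs
  have hsmul : ∏ i, c • w i = c ^ D • s := by
    rw [Finset.prod_smul, Finset.prod_const, Finset.card_univ]
  rw [hsmul] at hprod
  set δ := c ^ D with hδ
  have hδ0 : 0 < δ := by positivity
  set r : AddMonoidAlgebra ℝ M := x ^ D - δ • s with hrdef
  have hsm : mass s = 1 := by rw [hs, map_prod]; simp [hwm]
  have hrm : mass r = 1 - δ := by
    rw [hrdef, map_sub, map_pow, hmass, map_smul, hsm]; simp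
  have hδ1 : δ ≤ 1 := by
    have : 0 ≤ mass r := by
      rw [mass_eq_sum]; exact Finset.sum_nonneg fun i _ => hprod i
    linarith
  have hspow : ∀ (m : ℕ) (j : M), (s ^ m).coeff j ≤ (√2 * (√(m + 1))⁻¹) ^ D := by
    intro m j
    -- Translating each coin by `-b` leaves products of `1 + X^(a i - b)`, whose monomials do not
    -- collide by `hinj`.
    have e : s ^ m = single (m • ∑ _i : ι, b) (((1 / 2 : ℝ) ^ D) ^ m) *
        ∏ i, (1 + single (a i - b) (1 : ℝ)) ^ m := by
      have e1 : ∀ i, w i = single b (1 / 2) * (1 + single (a i - b) (1 : ℝ)) := by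
        intro i
        rw [mul_add, single_mul_single, mul_one, mul_one, add_sub_cancel, hw]
        exact add_comm _ _
      rw [hs, Finset.prod_congr rfl fun i _ => e1 i, Finset.prod_mul_distrib, mul_pow,
        Finset.prod_pow, prod_single, single_pow]
      simp [hD]
    rw [e]
    refine (coeff_mul_le (coeffNonneg_single _ (by positivity))
      (coeff_prod_one_add_single_pow_le _ hinj m) j).trans ?_
    rw [mass_single, ← pow_mul, mul_comm D m, pow_mul, ← mul_pow]
    refine pow_le_pow_left₀ (by positivity) ?_ _
    refine le_trans (le_of_eq ?_) (choose_half_div_two_pow_le m)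
    rw [div_pow, one_pow, one_div, div_eq_inv_mul]
  obtain ⟨C, hC, hbin⟩ := exists_sum_binomial_inv_sqrt_pow_le hδ0 hδ1 D
  have hmain : ∀ (k : ℕ) (j : M), ((x ^ D) ^ k).coeff j ≤ √2 ^ D * C * ((√(k + 1))⁻¹) ^ D := by
    intro k j
    -- A mixture: each factor is `s` with weight `δ` and the remainder with mass `1 - δ`. The number
    -- `m` of factors `s` is binomial, and these alone control the supremum.
    have e : x ^ D = δ • s + r := by rw [hrdef]; abel
    rw [e, add_pow, coeff_sum, Finsupp.finsetSum_apply]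
    calc _ ≤ ∑ m ∈ Finset.range (k + 1), √2 ^ D * (δ ^ m * (1 - δ) ^ (k - m) * (k.choose m) *
          ((√(m + 1))⁻¹) ^ D) := by
          refine Finset.sum_le_sum fun m _ => ?_
          have e2 : (δ • s) ^ m * r ^ (k - m) * ((k.choose m : ℕ) : AddMonoidAlgebra ℝ M) =
              (single 0 (δ ^ m * (k.choose m)) * r ^ (k - m)) * s ^ m := by
            have e3 : δ • s = single 0 δ * s := by
              rw [show single (0 : M) δ = algebraMap ℝ (AddMonoidAlgebra ℝ M) δ from rfl,
                Algebra.smul_def]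
            have e4 : single (0 : M) (δ ^ m * (k.choose m : ℝ)) =
                (single 0 δ) ^ m * ((k.choose m : ℕ) : AddMonoidAlgebra ℝ M) := by
              rw [single_pow, natCast_def, single_mul_single]; simp
            rw [e3, e4, mul_pow]; ring
          rw [e2]
          refine (coeff_mul_le ((coeffNonneg_single _ (by positivity)).mul (hprod.pow _))
            (hspow m) j).trans (le_of_eq ?_)
          rw [map_mul, map_pow, hrm, mass_single, mul_pow]
          ring
      _ = √2 ^ D * _ := (Finset.mul_sum _ _ _).symm
      _ ≤ √2 ^ D * (C * ((√(k + 1))⁻¹) ^ D) := by gcongr; exact hbin k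
      _ = _ := by ring
  refine ⟨√2 ^ D * C * √D ^ D, by positivity, fun n j => ?_⟩
  -- The leftover `n % D` steps have mass one and cost nothing; `n + 1 ≤ D (n / D + 1)` accounts for
  -- the factor `√D ^ D`.
  have e : x ^ n = x ^ (n % D) * (x ^ D) ^ (n / D) := by
    rw [← pow_mul, ← pow_add, Nat.mod_add_div]
  rw [e]
  refine (coeff_mul_le (hx.pow _) (hmain (n / D)) j).trans ?_
  rw [map_pow, hmass, one_pow, one_mul, mul_assoc _ (√D ^ D), ← mul_pow]
  have h1 : (n + 1 : ℝ) ≤ D * ((n / D : ℕ) + 1) := by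
    have := Nat.lt_mul_div_succ n hDpos
    exact_mod_cast this
  have h2 : (√((n / D : ℕ) + 1))⁻¹ ≤ √D * (√(n + 1))⁻¹ := by
    rw [← div_eq_mul_inv, inv_eq_one_div, div_le_div_iff₀ (by positivity) (by positivity), one_mul,
      ← Real.sqrt_mul (by positivity)]
    exact Real.sqrt_le_sqrt h1
  gcongr

end AddMonoidAlgebra

namespace IsHarnessMatrix

variable {d : ℕ} {p : (Fin d → ℤ) → (Fin d → ℤ) → ℝ}

theorem finite_support (hp : IsHarnessMatrix p) : (Function.support (p 0)).Finite := by
  obtain ⟨v, hv⟩ := hp.finite_range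
  refine (ProperSpace.isCompact_closedBall (0 : Fin d → ℤ) v).finite_of_discrete.subset fun j hj => ?_
  rw [mem_closedBall_zero_iff]
  by_contra h
  exact hj (hv j (not_le.mp h))

/-- The step law of the walk, as an element of the group algebra. -/
noncomputable def stepLaw (hp : IsHarnessMatrix p) : AddMonoidAlgebra ℝ (Fin d → ℤ) :=
  .ofCoeff (Finsupp.ofSupportFinite (p 0) hp.finite_support)

theorem coeff_stepLaw (hp : IsHarnessMatrix p) (j : Fin d → ℤ) : hp.stepLaw.coeff j = p 0 j := rfl

theorem coeffNonneg_stepLaw (hp : IsHarnessMatrix p) : hp.stepLaw.CoeffNonneg := hp.nonneg 0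

theorem hasSum_stepLaw (hp : IsHarnessMatrix p) (f : (Fin d → ℤ) → ℝ) :
    HasSum (fun j => p 0 j * f j) (hp.stepLaw.coeff.sum fun j a => a * f j) := by
  apply hasSum_sum_of_ne_finset_zero
  intro j hj
  rw [Finsupp.notMem_support_iff, coeff_stepLaw] at hj
  rw [hj, zero_mul]

theorem mass_stepLaw (hp : IsHarnessMatrix p) : hp.stepLaw.mass = 1 := by
  rw [AddMonoidAlgebra.mass_eq_sum]
  have h := hp.hasSum_stepLaw fun _ => 1
  simp only [mul_one] at h
  exact h.unique (hp.sum_one 0)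

/-- The support of the step law affinely spans the whole space. -/
theorem span_sub_eq_top (hp : IsHarnessMatrix p) {b : Fin d → ℤ} :
    Submodule.span ℝ ((fun j : Fin d → ℤ => (fun k => ((j k - b k : ℤ) : ℝ) : Fin d → ℝ)) ''
      {j | p 0 j ≠ 0}) = ⊤ := by
  set V := Submodule.span ℝ ((fun j : Fin d → ℤ => (fun k => ((j k - b k : ℤ) : ℝ) : Fin d → ℝ)) ''
      {j | p 0 j ≠ 0}) with hV
  have hmem : ∀ j, p 0 j ≠ 0 → (fun k => ((j k - b k : ℤ) : ℝ) : Fin d → ℝ) ∈ V :=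
    fun j hj => Submodule.subset_span ⟨j, hj, rfl⟩
  -- Centering enters here: the mean of `j - b` under `p 0` is `-b`, so the differences already span
  -- `b`, hence the support and the lattice it generates.
  have hb : (fun k => (b k : ℝ) : Fin d → ℝ) ∈ V := by
    have h : ∑ j ∈ hp.stepLaw.coeff.support,
        p 0 j • (fun k => ((j k - b k : ℤ) : ℝ) : Fin d → ℝ) ∈ V := by
      refine Submodule.sum_mem _ fun j hj => V.smul_mem _ (hmem j ?_)
      rwa [Finsupp.mem_support_iff, coeff_stepLaw] at hj
    have e : ∑ j ∈ hp.stepLaw.coeff.support,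
        p 0 j • (fun k => ((j k - b k : ℤ) : ℝ) : Fin d → ℝ) = -(fun k => (b k : ℝ)) := by
      ext k
      have h1 : ∑ j ∈ hp.stepLaw.coeff.support, p 0 j * (j k : ℝ) = 0 :=
        (hp.hasSum_stepLaw fun j => (j k : ℝ)).unique (hp.mean_zero k)
      have h2 : ∑ j ∈ hp.stepLaw.coeff.support, p 0 j = 1 := by
        have := hp.mass_stepLaw
        rwa [AddMonoidAlgebra.mass_eq_sum] at this
      simp only [Finset.sum_apply, Pi.smul_apply, smul_eq_mul, Int.cast_sub, mul_sub,
        Finset.sum_sub_distrib, Pi.neg_apply]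
      rw [h1, ← Finset.sum_mul, h2]; ring
    rw [e] at h
    simpa using V.neg_mem h
  have hint : ∀ j : Fin d → ℤ, (fun k => (j k : ℝ) : Fin d → ℝ) ∈ V := by
    intro j
    have hj : j ∈ AddSubgroup.closure {j : Fin d → ℤ | p 0 j ≠ 0} := by
      rw [hp.generates]; trivial
    induction hj using AddSubgroup.closure_induction with
    | mem j hj =>
      convert V.add_mem (hmem j hj) hb using 1
      ext k; simp
    | zero =>
      convert V.zero_mem using 1
      ext k; simp
    | add x y _ _ hx hy =>
      convert V.add_mem hx hy using 1
      ext k; simp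
    | neg x _ hx =>
      convert V.neg_mem hx using 1
      ext k; simp
  rw [eq_top_iff]
  intro x _
  have hx : x = ∑ i, x i • (fun k => ((Pi.single i 1 : Fin d → ℤ) k : ℝ) : Fin d → ℝ) := by
    ext k
    simp [Finset.sum_apply, Pi.single_apply]
  rw [hx]
  exact V.sum_mem fun i _ => V.smul_mem _ (hint _)

/-- Heat kernel upper bound for the walk with step law `p 0`. -/
theorem exists_coeff_stepLaw_pow_le (hp : IsHarnessMatrix p) (hd : 0 < d) :
    ∃ C : ℝ, 0 < C ∧ ∀ (n : ℕ) (m : Fin d → ℤ), (hp.stepLaw ^ n).coeff m ≤ C * ((n + 1 : ℝ) ^ (-((d : ℝ) / 2))) := by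
  obtain ⟨b, hb⟩ : ∃ b, p 0 b ≠ 0 := by
    by_contra! h
    have h1 := hp.sum_one 0
    simp only [h] at h1
    exact zero_ne_one (hasSum_zero.unique h1)
  obtain ⟨B, hBs, hBspan, hBli⟩ := exists_linearIndependent ℝ
    ((fun j : Fin d → ℤ => (fun k => ((j k - b k : ℤ) : ℝ) : Fin d → ℝ)) '' {j | p 0 j ≠ 0})
  rw [hp.span_sub_eq_top] at hBspan
  have : Fintype B := hBli.setFinite.fintype
  have hcard : Fintype.card B = d := by
    have e := Module.finrank_eq_card_basis (Module.Basis.mk hBli (by simpa using hBspan.ge))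
    simpa using e.symm
  choose! a ha hab using fun x (hx : x ∈ B) => hBs hx
  have : Nonempty B := Fintype.card_pos_iff.mp (by rw [hcard]; exact hd)
  have hpos : ∀ j, p 0 j ≠ 0 → 0 < p 0 j := fun j hj => lt_of_le_of_ne (hp.nonneg 0 j) hj.symm
  obtain ⟨C, hC, h⟩ := AddMonoidAlgebra.exists_coeff_pow_le hp.stepLaw hp.coeffNonneg_stepLaw
    hp.mass_stepLaw (fun x : B => a x) b (fun x => hpos _ (ha x x.2)) (hpos _ hb) (by
      -- Equality of two natural combinations is a real linear relation among the basis vectors with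
      -- coefficients `β x - γ x`.
      intro β γ hβγ
      have hli := Fintype.linearIndependent_iff.mp hBli (fun x => (β x : ℝ) - γ x) (by
        ext k
        have hk := congrArg (fun f : Fin d → ℤ => ((f k : ℤ) : ℝ)) hβγ
        have hab' : ∀ x : B, (x : Fin d → ℝ) k = (a x k : ℝ) - b k := fun x => by
          have := congrFun (hab x x.2) k
          simpa using this.symm
        simp only [Finset.sum_apply, Pi.sub_apply, Int.cast_sum, nsmul_eq_mul,
          Pi.mul_apply, Pi.natCast_apply, Int.cast_mul, Int.cast_natCast, Int.cast_sub] at hk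
        simp only [Finset.sum_apply, Pi.smul_apply, smul_eq_mul, sub_mul, Finset.sum_sub_distrib,
          hab', Pi.zero_apply]
        linarith)
      ext x
      have := hli x
      exact_mod_cast sub_eq_zero.mp this)
  refine ⟨C, hC, fun n m => (h n m).trans (le_of_eq ?_)⟩
  rw [hcard, Real.rpow_neg (by positivity), Real.sqrt_eq_rpow, inv_pow, ← Real.rpow_natCast,
    ← Real.rpow_mul (by positivity)]
  congr 3; ring

end IsHarnessMatrix

/-! ### Moment generating function of the noise -/

namespace HasExpTail

variable {α c c' : ℝ} {F : Measure ℝ}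

theorem measure_lt_abs_le (hF : HasExpTail α c c' F) (hsym : F.map (fun x : ℝ => -x) = F)
    {x : ℝ} (hx : 0 < x) :
    F {y | x < |y|} ≤ 2 * ENNReal.ofReal (c * Real.exp (-c' * x ^ α)) := by
  have hneg : F (Set.Iio (-x)) = F (Set.Ioi x) := by
    conv_rhs => rw [← hsym]
    rw [Measure.map_apply measurable_neg measurableSet_Ioi]
    congr 1
    ext y
    simp
  have hsub : {y : ℝ | x < |y|} ⊆ Set.Ioi x ∪ Set.Iio (-x) := by
    intro y hy
    rcases lt_abs.mp (show x < |y| from hy) with h | h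
    · exact Or.inl h
    · exact Or.inr (by simpa [lt_neg] using h)
  calc F {y | x < |y|} ≤ F (Set.Ioi x) + F (Set.Iio (-x)) :=
        (measure_mono hsub).trans (measure_union_le _ _)
    _ = 2 * F (Set.Ioi x) := by rw [hneg, two_mul]
    _ ≤ _ := by gcongr; exact hF x hx

/-- Layer-cake formula. Halving the constant `c'` squares the decay: the level `t` is exceeded with
probability at most `2c t^(-2)`, whose integral over `(1, ∞)` is `2c`. -/
theorem lintegral_exp_le [IsProbabilityMeasure F] (hα : 1 ≤ α) (hc : 0 < c) (hc' : 0 < c')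
    (hF : HasExpTail α c c' F) (hsym : F.map (fun x : ℝ => -x) = F) :
    ∫⁻ x, ENNReal.ofReal (Real.exp (c' / 2 * |x| ^ α)) ∂F ≤ ENNReal.ofReal (1 + 2 * c) := by
  have hα0 : 0 < α := by linarith
  rw [lintegral_eq_lintegral_meas_lt F (Filter.Eventually.of_forall fun x => (Real.exp_pos _).le)
    (by fun_prop)]
  rw [← Set.Ioc_union_Ioi_eq_Ioi zero_le_one]
  refine (lintegral_union_le _ _ _).trans ?_
  rw [ENNReal.ofReal_add zero_le_one (by positivity)]
  gcongr
  · calc _ ≤ ∫⁻ _ in Set.Ioc (0 : ℝ) 1, 1 := lintegral_mono fun _ => prob_le_one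
      _ = _ := by simp
  · have hb : ∀ t ∈ Set.Ioi (1 : ℝ), F {a | t < Real.exp (c' / 2 * |a| ^ α)} ≤
        ENNReal.ofReal (2 * c * t ^ (-2 : ℝ)) := by
      intro t ht
      have ht0 : (0 : ℝ) < t := lt_trans one_pos ht
      have hlog : 0 < Real.log t := Real.log_pos ht
      set y : ℝ := (2 / c' * Real.log t) ^ (1 / α) with hy
      have hy0 : 0 < y := by positivity
      have hyα : y ^ α = 2 / c' * Real.log t := by
        rw [hy, ← Real.rpow_mul (by positivity), one_div_mul_cancel hα0.ne', Real.rpow_one]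
      have hsub : {a : ℝ | t < Real.exp (c' / 2 * |a| ^ α)} ⊆ {a | y < |a|} := by
        intro a ha
        have h1 : Real.log t < c' / 2 * |a| ^ α := (Real.log_lt_iff_lt_exp ht0).mpr ha
        have h2 : y ^ α < |a| ^ α := by
          rw [hyα, div_mul_eq_mul_div, div_lt_iff₀ hc']; linarith
        exact (Real.rpow_lt_rpow_iff hy0.le (abs_nonneg a) hα0).mp h2
      refine ((measure_mono hsub).trans (hF.measure_lt_abs_le hsym hy0)).trans (le_of_eq ?_)
      rw [show (2 : ENNReal) = ENNReal.ofReal 2 by simp, ← ENNReal.ofReal_mul (by norm_num)]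
      congr 1
      rw [hyα, Real.rpow_def_of_pos ht0, mul_assoc]
      congr 3
      field_simp
    calc _ ≤ ∫⁻ t in Set.Ioi (1 : ℝ), ENNReal.ofReal (2 * c * t ^ (-2 : ℝ)) :=
          setLIntegral_mono' measurableSet_Ioi hb
      _ = ENNReal.ofReal (∫ t in Set.Ioi (1 : ℝ), 2 * c * t ^ (-2 : ℝ)) := by
          rw [ofReal_integral_eq_lintegral_ofReal]
          · exact (integrableOn_Ioi_rpow_of_lt (by norm_num) one_pos).const_mul _
          · filter_upwards [ae_restrict_mem measurableSet_Ioi] with t ht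
            have : (0 : ℝ) < t := lt_trans one_pos ht
            simp only [Pi.zero_apply]
            positivity
      _ ≤ _ := by
          rw [integral_const_mul, integral_Ioi_rpow_of_lt (by norm_num) one_pos]
          norm_num

theorem integrable_exp [IsProbabilityMeasure F] (hα : 1 ≤ α) (hc : 0 < c) (hc' : 0 < c')
    (hF : HasExpTail α c c' F) (hsym : F.map (fun x : ℝ => -x) = F) :
    Integrable (fun x => Real.exp (c' / 2 * |x| ^ α)) F := by
  refine ⟨Measurable.aestronglyMeasurable (by fun_prop), ?_⟩
  rw [hasFiniteIntegral_iff_ofReal (Filter.Eventually.of_forall fun x => (Real.exp_pos _).le)]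
  exact (hF.lintegral_exp_le hα hc hc' hsym).trans_lt ENNReal.ofReal_lt_top

theorem integral_exp_le [IsProbabilityMeasure F] (hα : 1 ≤ α) (hc : 0 < c) (hc' : 0 < c')
    (hF : HasExpTail α c c' F) (hsym : F.map (fun x : ℝ => -x) = F) :
    ∫ x, Real.exp (c' / 2 * |x| ^ α) ∂F ≤ 1 + 2 * c := by
  rw [integral_eq_lintegral_of_nonneg_ae (Filter.Eventually.of_forall fun x => (Real.exp_pos _).le)
    (Measurable.aestronglyMeasurable (by fun_prop))]
  exact ENNReal.toReal_le_of_le_ofReal (by positivity) (hF.lintegral_exp_le hα hc hc' hsym)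

end HasExpTail

theorem abs_le_one_add_rpow {α : ℝ} (hα : 1 ≤ α) (x : ℝ) : |x| ≤ 1 + |x| ^ α := by
  rcases le_total |x| 1 with h | h
  · have := Real.rpow_nonneg (abs_nonneg x) α
    linarith
  · have := Real.rpow_le_rpow_of_exponent_le h hα
    rw [Real.rpow_one] at this
    linarith

/-- Termwise comparison of power series, as `l^(2n) ≤ l²` for `n ≥ 1`. It gives the quadratic
behaviour near `0` of the moment generating function of a symmetric law. -/
theorem Real.cosh_mul_le {l : ℝ} (hl : 0 ≤ l) (hl1 : l ≤ 1) (y : ℝ) :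
    Real.cosh (l * y) ≤ l ^ 2 * Real.cosh y + (1 - l ^ 2) := by
  have h1 := Real.hasSum_cosh (l * y)
  have h2 := ((Real.hasSum_cosh y).mul_left (l ^ 2)).add
    (hasSum_ite_eq (0 : ℕ) (1 - l ^ 2))
  refine hasSum_le (fun n => ?_) h1 h2
  rcases Nat.eq_zero_or_pos n with rfl | hn
  · simp
  · rw [if_neg hn.ne', add_zero, mul_pow, mul_div_assoc]
    have : 0 ≤ y ^ (2 * n) / ((2 * n).factorial : ℝ) := by
      rw [pow_mul]; positivity
    exact mul_le_mul_of_nonneg_right (pow_le_pow_of_le_one hl hl1 (by omega)) this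

/-- The function `y` for `y ≤ 1` and `y ^ β` for `y > 1`; the logarithmic moment generating function
of the noise at `s` grows at most like `s` times it. -/
noncomputable def growth (β y : ℝ) : ℝ := if y ≤ 1 then y else y ^ β

theorem growth_of_le_one {β y : ℝ} (h : y ≤ 1) : growth β y = y := if_pos h

theorem growth_of_one_lt {β y : ℝ} (h : 1 < y) : growth β y = y ^ β := if_neg (not_le.mpr h)

theorem growth_nonneg {β y : ℝ} (h : 0 ≤ y) : 0 ≤ growth β y := by
  unfold growth; split_ifs <;> positivity

theorem growth_mono {β y z : ℝ} (hβ : 0 ≤ β) (h : y ≤ z) : growth β y ≤ growth β z := by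
  rcases le_or_gt y 1 with h1 | h1
  · rcases le_or_gt z 1 with h2 | h2
    · rwa [growth_of_le_one h1, growth_of_le_one h2]
    · rw [growth_of_le_one h1, growth_of_one_lt h2]
      exact h1.trans (Real.one_le_rpow h2.le hβ)
  · rw [growth_of_one_lt h1, growth_of_one_lt (h1.trans_le h)]
    exact Real.rpow_le_rpow (by linarith) h hβ

/-- Bounds for the moment generating function of a symmetric law with exponential tails. -/
theorem exists_integral_exp_le_exp_growth {α c c' : ℝ} (hα : 1 ≤ α) (hc : 0 < c) (hc' : 0 < c') :
    ∃ C : ℝ, 0 < C ∧ ∀ (F : Measure ℝ) [IsProbabilityMeasure F],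
      HasExpTail α c c' F → F.map (fun x : ℝ => -x) = F →
      ∀ s : ℝ, 0 ≤ s → (s ≤ c' / 2 ∨ 1 < α) → Integrable (fun x => Real.exp (-(s * x))) F ∧
        ∫ x, Real.exp (-(s * x)) ∂F ≤ Real.exp (C * s * growth (1 / (α - 1)) (s / (c' / 2))) := by
  set s₀ := c' / 2 with hs₀
  have hs₀pos : 0 < s₀ := by positivity
  set K : ℝ := Real.exp s₀ * (1 + 2 * c) with hK
  have hKpos : 0 < K := by positivity
  -- Chosen for both regimes: `K ≤ C₁ s₀` when `s ≤ s₀`, and when `s > s₀` the first summand absorbs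
  -- the additive `2c` while the `1` pays for `s R^β`.
  set C₁ := (K + 2 * c + 1) / s₀ + 1 with hC₁
  refine ⟨C₁, by positivity, fun F _ hF hsym s hs hcase => ?_⟩
  have hint₀ := hF.integrable_exp hα hc hc' hsym
  have hbd₀ := hF.integral_exp_le hα hc hc' hsym
  rw [← hs₀] at hint₀ hbd₀
  rcases le_or_gt s s₀ with hle | hgt
  · rw [growth_of_le_one ((div_le_one hs₀pos).mpr hle)]
    have hdom : ∀ u : ℝ, |u| ≤ s₀ → ∀ x : ℝ,
        Real.exp (u * x) ≤ Real.exp s₀ * Real.exp (s₀ * |x| ^ α) := by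
      intro u hu x
      rw [← Real.exp_add, Real.exp_le_exp]
      calc u * x ≤ |u| * |x| := by rw [← abs_mul]; exact le_abs_self _
        _ ≤ s₀ * (1 + |x| ^ α) := by
            gcongr
            exact abs_le_one_add_rpow hα x
        _ = _ := by ring
    have hint : ∀ u : ℝ, |u| ≤ s₀ → Integrable (fun x => Real.exp (u * x)) F := by
      intro u hu
      refine (hint₀.const_mul (Real.exp s₀)).mono' (by fun_prop)
        (Filter.Eventually.of_forall fun x => ?_)
      rw [Real.norm_eq_abs, abs_of_pos (Real.exp_pos _)]
      exact hdom u hu x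
    have hbd : ∀ u : ℝ, |u| ≤ s₀ → ∫ x, Real.exp (u * x) ∂F ≤ K := by
      intro u hu
      refine (integral_mono (hint u hu) (hint₀.const_mul (Real.exp s₀)) (hdom u hu)).trans ?_
      rw [integral_const_mul, hK]
      gcongr
    have habs : |s| ≤ s₀ := by rwa [abs_of_nonneg hs]
    have habs' : |-s| ≤ s₀ := by rwa [abs_neg]
    have habs₀ : |s₀| ≤ s₀ := by rw [abs_of_pos hs₀pos]
    have habs₀' : |-s₀| ≤ s₀ := by rwa [abs_neg]
    have hcosh : ∀ u : ℝ, |u| ≤ s₀ → Integrable (fun x => Real.cosh (u * x)) F := by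
      intro u hu
      have h := ((hint u hu).add (hint (-u) (by rwa [abs_neg]))).div_const 2
      refine h.congr (Filter.Eventually.of_forall fun x => ?_)
      simp [Real.cosh_eq]
    have hcosh_bd : ∫ x, Real.cosh (s₀ * x) ∂F ≤ K := by
      have e : ∀ x : ℝ, Real.cosh (s₀ * x) = (Real.exp (s₀ * x) + Real.exp (-s₀ * x)) / 2 := by
        intro x; rw [Real.cosh_eq, neg_mul]
      simp_rw [e]
      rw [integral_div, integral_add (hint _ habs₀) (hint _ habs₀')]
      linarith [hbd _ habs₀, hbd _ habs₀']
    have hsymint : ∫ x, Real.exp (-(s * x)) ∂F = ∫ x, Real.exp (s * x) ∂F := by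
      conv_rhs => rw [← hsym]
      rw [integral_map (by fun_prop) (by fun_prop)]
      simp
    have hint_neg : Integrable (fun x => Real.exp (-(s * x))) F := by
      simpa using hint (-s) habs'
    refine ⟨hint_neg, ?_⟩
    -- Symmetry removes the odd part, leaving a `cosh` with no linear term in `s`.
    have heq : ∫ x, Real.exp (-(s * x)) ∂F = ∫ x, Real.cosh (s * x) ∂F := by
      simp_rw [Real.cosh_eq]
      rw [integral_div, integral_add (hint _ habs) hint_neg, ← hsymint]
      ring
    set l := s / s₀ with hl
    have hl0 : 0 ≤ l := by positivity
    have hl1 : l ≤ 1 := (div_le_one hs₀pos).mpr hle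
    have hsl : s = l * s₀ := by rw [hl]; field_simp
    rw [heq]
    calc ∫ x, Real.cosh (s * x) ∂F ≤ ∫ x, (l ^ 2 * Real.cosh (s₀ * x) + (1 - l ^ 2)) ∂F := by
          refine integral_mono (hcosh s habs)
            (((hcosh s₀ habs₀).const_mul _).add (integrable_const _)) fun x => ?_
          have := Real.cosh_mul_le hl0 hl1 (s₀ * x)
          rwa [← mul_assoc, ← hsl] at this
      _ = l ^ 2 * ∫ x, Real.cosh (s₀ * x) ∂F + (1 - l ^ 2) := by
          rw [integral_add ((hcosh s₀ habs₀).const_mul _) (integrable_const _),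
            integral_const_mul]
          simp
      _ ≤ l ^ 2 * K + 1 := by
          have := mul_le_mul_of_nonneg_left hcosh_bd (sq_nonneg l)
          nlinarith [sq_nonneg l]
      _ ≤ Real.exp (l ^ 2 * K) := Real.add_one_le_exp _
      _ ≤ Real.exp (C₁ * s * l) := by
          rw [Real.exp_le_exp, hsl]
          have : K ≤ C₁ * s₀ := by
            rw [hC₁, add_mul, div_mul_cancel₀ _ hs₀pos.ne']; linarith
          nlinarith [mul_le_mul_of_nonneg_left this (sq_nonneg l)]
  · have hα1 : 1 < α := hcase.resolve_left (not_le.mpr hgt)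
    set β := 1 / (α - 1) with hβ
    have hβ0 : 0 < β := by rw [hβ]; exact one_div_pos.mpr (by linarith)
    have hr : 1 < s / s₀ := (one_lt_div hs₀pos).mpr hgt
    rw [growth_of_one_lt hr]
    set R := s / s₀ with hR
    -- Young's inequality by splitting at `|x| = R^β`: beyond it `|x|^(α-1) ≥ R`, so `s|x|` is at
    -- most `s₀|x|^α`, whose exponential is integrable.
    have hyoung : ∀ x : ℝ, -(s * x) ≤ s * R ^ β + s₀ * |x| ^ α := by
      intro x
      have h1 : -(s * x) ≤ s * |x| := by
        rw [← mul_neg]; exact mul_le_mul_of_nonneg_left (neg_le_abs x) hs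
      rcases le_total |x| (R ^ β) with h | h
      · have h2 := mul_le_mul_of_nonneg_left h hs
        have : 0 ≤ s₀ * |x| ^ α := by positivity
        linarith
      · have hxpos : 0 < |x| := lt_of_lt_of_le (by positivity) h
        have h2 : R ≤ |x| ^ (α - 1) := by
          have := Real.rpow_le_rpow (by positivity) h (show 0 ≤ α - 1 by linarith)
          rwa [← Real.rpow_mul (by positivity), hβ, one_div_mul_cancel (by linarith),
            Real.rpow_one] at this
        have h3 : |x| ^ α = |x| ^ (α - 1) * |x| := by
          rw [Real.rpow_sub_one hxpos.ne']; field_simp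
        have h4 : s * |x| ≤ s₀ * |x| ^ α := by
          rw [h3, ← mul_assoc]
          refine mul_le_mul_of_nonneg_right ?_ hxpos.le
          calc s = s₀ * R := by rw [hR]; field_simp
            _ ≤ _ := by gcongr
        have : 0 ≤ s * R ^ β := by positivity
        linarith
    have hdom : ∀ x : ℝ, Real.exp (-(s * x)) ≤ Real.exp (s * R ^ β) * Real.exp (s₀ * |x| ^ α) :=
      fun x => by rw [← Real.exp_add, Real.exp_le_exp]; exact hyoung x
    have hint : Integrable (fun x => Real.exp (-(s * x))) F := by
      refine (hint₀.const_mul (Real.exp (s * R ^ β))).mono' (by fun_prop)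
        (Filter.Eventually.of_forall fun x => ?_)
      rw [Real.norm_eq_abs, abs_of_pos (Real.exp_pos _)]
      exact hdom x
    refine ⟨hint, ?_⟩
    calc _ ≤ ∫ x, Real.exp (s * R ^ β) * Real.exp (s₀ * |x| ^ α) ∂F :=
          integral_mono hint (hint₀.const_mul _) hdom
      _ = Real.exp (s * R ^ β) * ∫ x, Real.exp (s₀ * |x| ^ α) ∂F := integral_const_mul _ _
      _ ≤ Real.exp (s * R ^ β) * Real.exp (2 * c) := by
          gcongr
          have := Real.add_one_le_exp (2 * c)
          linarith
      _ = Real.exp (s * R ^ β + 2 * c) := (Real.exp_add _ _).symm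
      _ ≤ _ := by
          rw [Real.exp_le_exp]
          have h1 : 1 ≤ R ^ β := Real.one_le_rpow hr.le hβ0.le
          have hsR : s = s₀ * R := by rw [hR]; field_simp
          have h2 : 2 * c ≤ (K + 2 * c + 1) / s₀ * s * R ^ β := by
            have e : (K + 2 * c + 1) / s₀ * s = (K + 2 * c + 1) * R := by rw [hR]; ring
            rw [e, mul_assoc]
            have h3 : 1 ≤ R * R ^ β := one_le_mul_of_one_le_of_one_le hr.le h1
            nlinarith
          rw [hC₁]
          linarith

/-! ### The process without wall and the comparison with the wall process -/

namespace AddMonoidAlgebra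

variable {M : Type*} [AddCommGroup M]

/-- The action of the group algebra on functions: `average x f i = ∑ j, x j * f (i + j)`. -/
noncomputable def average : AddMonoidAlgebra ℝ M →ₐ[ℝ] Module.End ℝ (M → ℝ) :=
  AddMonoidAlgebra.lift ℝ (Module.End ℝ (M → ℝ)) M
    { toFun := fun u => LinearMap.funLeft ℝ ℝ fun i => i + u.toAdd
      map_one' := by
        ext f i
        simp [LinearMap.funLeft_apply]
      map_mul' := fun u v => by
        ext f i
        simp [LinearMap.funLeft_apply, add_assoc] }

theorem average_apply (x : AddMonoidAlgebra ℝ M) (f : M → ℝ) (i : M) :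
    average x f i = x.coeff.sum fun j a => a * f (i + j) := by
  simp [average, AddMonoidAlgebra.lift_apply, Finsupp.sum, LinearMap.sum_apply, Finset.sum_apply,
    LinearMap.funLeft_apply]

theorem average_const (x : AddMonoidAlgebra ℝ M) (a : ℝ) (i : M) :
    average x (fun _ => a) i = mass x * a := by
  rw [average_apply, mass_eq_sum, Finsupp.sum, Finsupp.sum, Finset.sum_mul]

theorem average_mono {x : AddMonoidAlgebra ℝ M} (hx : CoeffNonneg x) {f g : M → ℝ} {i : M}
    (h : ∀ j, x.coeff j ≠ 0 → f (i + j) ≤ g (i + j)) : average x f i ≤ average x g i := by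
  rw [average_apply, average_apply]
  exact Finset.sum_le_sum fun j hj =>
    mul_le_mul_of_nonneg_left (h j (Finsupp.mem_support_iff.mp hj)) (hx j)

/-- The process without wall driven by the noise values `e n i`. -/
noncomputable def harness (x : AddMonoidAlgebra ℝ M) (e : ℕ → M → ℝ) : ℕ → M → ℝ
  | 0 => 0
  | n + 1 => average x (harness x e n) + e (n + 1)

/-- Duhamel's formula: noise that is `k` steps old has been spread by the `k`-step law. -/
theorem harness_eq_sum (x : AddMonoidAlgebra ℝ M) (e : ℕ → M → ℝ) (n : ℕ) :
    harness x e n = ∑ k ∈ Finset.range n, average (x ^ k) (e (n - k)) := by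
  induction n with
  | zero => rfl
  | succ n ih =>
    rw [harness, ih, Finset.sum_range_succ', map_sum]
    congr 1
    · refine Finset.sum_congr rfl fun k _ => ?_
      rw [pow_succ', map_mul, Module.End.mul_apply, Nat.add_sub_add_right]
    · simp

theorem harness_apply (x : AddMonoidAlgebra ℝ M) (e : ℕ → M → ℝ) (n : ℕ) (i : M) :
    harness x e n i = ∑ k ∈ Finset.range n, ∑ j ∈ (x ^ k).coeff.support,
      (x ^ k).coeff j * e (n - k) (i + j) := by
  rw [harness_eq_sum, Finset.sum_apply]
  exact Finset.sum_congr rfl fun k _ => average_apply _ _ _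

end AddMonoidAlgebra

namespace IsHarnessMatrix

variable {d : ℕ} {p : (Fin d → ℤ) → (Fin d → ℤ) → ℝ}

theorem tsum_eq_average (hp : IsHarnessMatrix p) (f : (Fin d → ℤ) → ℝ) (i : Fin d → ℤ) :
    ∑' j, p i j * f j = AddMonoidAlgebra.average hp.stepLaw f i := by
  rw [AddMonoidAlgebra.average_apply, ← (hp.hasSum_stepLaw fun j => f (i + j)).tsum_eq,
    ← (Equiv.addLeft i).tsum_eq]
  refine tsum_congr fun j => ?_
  rw [hp.homogeneous]
  simp

theorem wall_succ (hp : IsHarnessMatrix p) (e : ℕ → (Fin d → ℤ) → ℝ) (n : ℕ) (i : Fin d → ℤ) :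
    wall p e (n + 1) i =
      max (AddMonoidAlgebra.average hp.stepLaw (wall p e n) i + e (n + 1) i) 0 := by
  rw [← hp.tsum_eq_average]
  rfl

/-- Raising the free process by the depth it reaches in the backward cone dominates the wall
process. -/
theorem wall_le_harness_add (hp : IsHarnessMatrix p) {v : ℕ}
    (hv : ∀ j : Fin d → ℤ, (v : ℝ) < ‖j‖ → p 0 j = 0) (e : ℕ → (Fin d → ℤ) → ℝ) (n : ℕ) {a : ℝ}
    (ha : 0 ≤ a) (hcone : ∀ m ∈ Finset.Icc 1 n, ∀ i : Fin d → ℤ, ‖i‖ ≤ v * n →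
      -a ≤ hp.stepLaw.harness e m i) :
    ∀ m ≤ n, ∀ i : Fin d → ℤ, ‖i‖ ≤ v * ((n : ℝ) - m) →
      wall p e m i ≤ hp.stepLaw.harness e m i + a := by
  intro m
  induction m with
  | zero => intro _ i _; simpa [wall, AddMonoidAlgebra.harness] using ha
  | succ m ih =>
    intro hm i hi
    rw [hp.wall_succ]
    have hbig : (v : ℝ) * ((n : ℝ) - (m + 1 : ℕ)) ≤ v * n := by
      gcongr
      have : (0 : ℝ) ≤ (m + 1 : ℕ) := Nat.cast_nonneg _
      linarith
    -- Where the wall acts, the height is `0` and the depth bound suffices; elsewhere averaging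
    -- preserves the inequality, since the averages have mass one and range `v` and stay in the
    -- cone.
    refine max_le ?_ (by
      linarith [hcone (m + 1) (Finset.mem_Icc.mpr ⟨by omega, hm⟩) i (hi.trans hbig)])
    have h := AddMonoidAlgebra.average_mono hp.coeffNonneg_stepLaw (i := i)
      (f := wall p e m) (g := hp.stepLaw.harness e m + fun _ => a) (fun j hj => by
        refine ih (by omega) _ ?_
        have hj' : ‖j‖ ≤ v := by
          by_contra hlt
          exact hj (hv j (not_le.mp hlt))
        calc ‖i + j‖ ≤ ‖i‖ + ‖j‖ := norm_add_le _ _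
          _ ≤ v * ((n : ℝ) - (m + 1 : ℕ)) + v := add_le_add hi hj'
          _ = _ := by push_cast; ring)
    rw [map_add, Pi.add_apply, AddMonoidAlgebra.average_const, hp.mass_stepLaw, one_mul] at h
    rw [AddMonoidAlgebra.harness, Pi.add_apply]
    linarith

end IsHarnessMatrix

/-! ### Exponential moments and the mean height -/

namespace IsNoise

variable {d : ℕ} {Ω : Type*} [MeasurableSpace Ω] {P : Measure Ω}
  {ε : ℕ → (Fin d → ℤ) → Ω → ℝ} {F : Measure ℝ}

theorem isProbabilityMeasure [IsProbabilityMeasure P] (hε : IsNoise P ε F) :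
    IsProbabilityMeasure F := by
  rw [← hε.law 0 0]
  exact Measure.isProbabilityMeasure_map (hε.measurable 0 0).aemeasurable

theorem integrable_noise (hε : IsNoise P ε F) (n : ℕ) (i : Fin d → ℤ) : Integrable (ε n i) P := by
  have h := hε.integrable
  rw [← hε.law n i] at h
  exact h.comp_measurable (hε.measurable n i)

theorem integral_noise (hε : IsNoise P ε F) (n : ℕ) (i : Fin d → ℤ) : ∫ ω, ε n i ω ∂P = 0 := by
  have h1 : ∫ ω, ε n i ω ∂P = ∫ x, x ∂F := by
    rw [← hε.law n i, integral_map (hε.measurable n i).aemeasurable (by fun_prop)]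
  have h2 : ∫ x, x ∂F = -∫ x, x ∂F := by
    conv_lhs => rw [← hε.symmetric]
    rw [integral_map (by fun_prop) (by fun_prop), integral_neg]
  rw [h1]; linarith

theorem integrable_average (x : AddMonoidAlgebra ℝ (Fin d → ℤ)) {f : (Fin d → ℤ) → Ω → ℝ}
    (hf : ∀ i, Integrable (f i) P) (i : Fin d → ℤ) :
    Integrable (fun ω => AddMonoidAlgebra.average x (fun j => f j ω) i) P := by
  simp_rw [AddMonoidAlgebra.average_apply]
  exact integrable_finsetSum _ fun j _ => (hf _).const_mul _

theorem integrable_harness (hε : IsNoise P ε F) (x : AddMonoidAlgebra ℝ (Fin d → ℤ)) (n : ℕ)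
    (i : Fin d → ℤ) : Integrable (fun ω => x.harness (fun m j => ε m j ω) n i) P := by
  simp_rw [AddMonoidAlgebra.harness_apply]
  exact integrable_finsetSum _ fun k _ => integrable_finsetSum _ fun j _ =>
    (hε.integrable_noise _ _).const_mul _

theorem integral_harness (hε : IsNoise P ε F) (x : AddMonoidAlgebra ℝ (Fin d → ℤ)) (n : ℕ)
    (i : Fin d → ℤ) : ∫ ω, x.harness (fun m j => ε m j ω) n i ∂P = 0 := by
  simp_rw [AddMonoidAlgebra.harness_apply]
  rw [integral_finsetSum _ fun k _ => integrable_finsetSum _ fun j _ =>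
    (hε.integrable_noise _ _).const_mul _]
  refine Finset.sum_eq_zero fun k _ => ?_
  rw [integral_finsetSum _ fun j _ => (hε.integrable_noise _ _).const_mul _]
  refine Finset.sum_eq_zero fun j _ => ?_
  rw [integral_const_mul, hε.integral_noise, mul_zero]

theorem integrable_wall (hε : IsNoise P ε F) {p : (Fin d → ℤ) → (Fin d → ℤ) → ℝ}
    (hp : IsHarnessMatrix p) (n : ℕ) (i : Fin d → ℤ) :
    Integrable (fun ω => wall p (fun m j => ε m j ω) n i) P := by
  induction n generalizing i with
  | zero => simp [wall]
  | succ n ih =>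
    simp_rw [hp.wall_succ]
    exact ((integrable_average _ ih i).add (hε.integrable_noise _ _)).pos_part

/-- The exponential moments of the free process factorize over the noise variables. -/
theorem integral_exp_harness_le (hε : IsNoise P ε F) (x : AddMonoidAlgebra ℝ (Fin d → ℤ)) (n : ℕ)
    (i : Fin d → ℤ) (t : ℝ) (G : ℕ → (Fin d → ℤ) → ℝ)
    (h : ∀ k < n, ∀ j, Integrable (fun y => Real.exp (-(t * (x ^ k).coeff j * y))) F ∧
      ∫ y, Real.exp (-(t * (x ^ k).coeff j * y)) ∂F ≤ Real.exp (G k j)) :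
    Integrable (fun ω => Real.exp (-(t * x.harness (fun m j => ε m j ω) n i))) P ∧
      ∫ ω, Real.exp (-(t * x.harness (fun m j => ε m j ω) n i)) ∂P ≤
        Real.exp (∑ k ∈ Finset.range n, ∑ j ∈ (x ^ k).coeff.support, G k j) := by
  have : IsProbabilityMeasure P := hε.indep.isProbabilityMeasure
  set T : Finset (Σ _ : ℕ, Fin d → ℤ) :=
    (Finset.range n).sigma fun k => (x ^ k).coeff.support with hT
  have hlt : ∀ q : T, q.1.1 < n := fun q =>
    Finset.mem_range.mp (Finset.mem_sigma.mp q.2).1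
  set g : T → ℕ × (Fin d → ℤ) := fun q => (n - q.1.1, i + q.1.2) with hg
  -- Distinct pairs `(k, j)` use distinct noise variables. The truncated subtraction `n - k`
  -- determines `k` only because `k < n`.
  have hginj : Function.Injective g := by
    rintro ⟨⟨k, j⟩, hq⟩ ⟨⟨k', j'⟩, hq'⟩ heq
    have h1 := hlt ⟨⟨k, j⟩, hq⟩
    have h2 := hlt ⟨⟨k', j'⟩, hq'⟩
    simp only [hg, Prod.mk.injEq, add_right_inj] at heq h1 h2
    obtain ⟨h3, rfl⟩ := heq
    obtain rfl : k = k' := by omega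
    rfl
  set X : T → Ω → ℝ := fun q ω =>
    -((x ^ q.1.1).coeff q.1.2) * ε (n - q.1.1) (i + q.1.2) ω with hX
  have hmeas : ∀ q, Measurable (X q) := fun q => (hε.measurable _ _).const_mul _
  have hind : iIndepFun X P :=
    (hε.indep.precomp hginj).comp (fun q y => -((x ^ q.1.1).coeff q.1.2) * y)
      (fun q => measurable_const_mul _)
  have hsum : ∀ ω, -(t * x.harness (fun m j => ε m j ω) n i) = t * (∑ q, X q) ω := by
    intro ω
    rw [AddMonoidAlgebra.harness_apply, Finset.sum_apply, Finset.sum_sigma',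
      ← Finset.sum_coe_sort T, ← mul_neg, ← Finset.sum_neg_distrib]
    simp [hX]
  have hexp : ∀ q ω, Real.exp (t * X q ω) =
      Real.exp (-(t * (x ^ q.1.1).coeff q.1.2 * ε (n - q.1.1) (i + q.1.2) ω)) := by
    intro q ω
    congr 1
    simp only [hX]; ring
  have hXint : ∀ q, Integrable (fun ω => Real.exp (t * X q ω)) P := by
    intro q
    simp_rw [hexp]
    have h1 := (h q.1.1 (hlt q) q.1.2).1
    rw [← hε.law (n - q.1.1) (i + q.1.2)] at h1
    exact h1.comp_measurable (hε.measurable _ _)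
  have hXle : ∀ q, mgf (X q) P t ≤ Real.exp (G q.1.1 q.1.2) := by
    intro q
    rw [mgf]
    simp_rw [hexp]
    have h1 := (h q.1.1 (hlt q) q.1.2).2
    rw [← hε.law (n - q.1.1) (i + q.1.2),
      integral_map (hε.measurable _ _).aemeasurable (by fun_prop)] at h1
    exact h1
  simp_rw [hsum]
  refine ⟨hind.integrable_exp_mul_sum hmeas fun q _ => hXint q, ?_⟩
  have hmgf := hind.mgf_sum hmeas (t := t) Finset.univ
  rw [mgf] at hmgf
  rw [hmgf, Finset.sum_sigma', ← Finset.sum_coe_sort T, Real.exp_sum]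
  exact Finset.prod_le_prod (fun q _ => mgf_nonneg) fun q _ => hXle q

/-- Upper bound for the mean height of the wall process in terms of the exponential moments of the
free process. -/
theorem wallMean_le (hε : IsNoise P ε F) {p : (Fin d → ℤ) → (Fin d → ℤ) → ℝ}
    (hp : IsHarnessMatrix p) {v : ℕ} (hv : ∀ j : Fin d → ℤ, (v : ℝ) < ‖j‖ → p 0 j = 0)
    {n : ℕ} (hn : 1 ≤ n) {t Λ : ℝ} (ht : 0 < t) (hΛ : 0 ≤ Λ)
    (h : ∀ m ≤ n, ∀ i,
      Integrable (fun ω => Real.exp (-(t * hp.stepLaw.harness (fun m j => ε m j ω) m i))) P ∧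
      ∫ ω, Real.exp (-(t * hp.stepLaw.harness (fun m j => ε m j ω) m i)) ∂P ≤ Real.exp Λ) :
    wallMean P p ε n ≤ ((d + 1) * Real.log n + Λ + (2 * v + 1) ^ d) / t := by
  have : IsProbabilityMeasure P := hε.indep.isProbabilityMeasure
  -- The level `lam` below satisfies `n^(d+1) exp(Λ - t * lam) = 1`, so the sum over the space-time
  -- box contributes only the constant `(2v+1)^d / t`.
  have hn1 : (1 : ℝ) ≤ n := by exact_mod_cast hn
  set lam : ℝ := ((d + 1) * Real.log n + Λ) / t with hlam
  have hlam0 : 0 ≤ lam := by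
    have := Real.log_nonneg hn1
    positivity
  set Z : ℕ → (Fin d → ℤ) → Ω → ℝ := fun m i ω => hp.stepLaw.harness (fun m j => ε m j ω) m i
    with hZ
  set box : Finset (Fin d → ℤ) := Finset.Icc (fun _ => -(v * n : ℤ)) (fun _ => (v * n : ℤ)) with hbox
  have hmem : ∀ i : Fin d → ℤ, ‖i‖ ≤ v * n → i ∈ box := by
    intro i hi
    rw [hbox, Finset.mem_Icc, Pi.le_def, Pi.le_def, ← forall_and]
    intro k
    have h1 := (norm_le_pi_norm i k).trans hi
    rw [Int.norm_eq_abs] at h1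
    exact abs_le.mp (by exact_mod_cast h1)
  have hcard : (box.card : ℝ) ≤ (2 * v + 1) ^ d * (n : ℝ) ^ d := by
    have e : box.card = (2 * (v * n) + 1) ^ d := by
      rw [hbox, Pi.card_Icc, Finset.prod_const, Int.card_Icc, Finset.card_univ, Fintype.card_fin]
      congr 1
      omega
    rw [e, ← mul_pow]
    push_cast
    refine pow_le_pow_left₀ (by positivity) ?_ _
    nlinarith
  -- An integrable bound for the depth: `u + 1 ≤ exp u` gives `-Z ≤ lam + exp(-t * lam - t * Z) /
  -- t`, and a sum of positive terms replaces the maximum over the box.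
  set A : Ω → ℝ := fun ω => lam + ∑ m ∈ Finset.Icc 1 n, ∑ i ∈ box,
    Real.exp (-(t * lam)) / t * Real.exp (-(t * Z m i ω)) with hA
  have hterm : ∀ m ∈ Finset.Icc 1 n, ∀ i,
      Integrable (fun ω => Real.exp (-(t * lam)) / t * Real.exp (-(t * Z m i ω))) P :=
    fun m hm i => (h m (Finset.mem_Icc.mp hm).2 i).1.const_mul _
  have hsumint : Integrable (fun ω => ∑ m ∈ Finset.Icc 1 n, ∑ i ∈ box,
      Real.exp (-(t * lam)) / t * Real.exp (-(t * Z m i ω))) P :=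
    integrable_finsetSum _ fun m hm => integrable_finsetSum _ fun i _ => hterm m hm i
  have hAint : Integrable A P := (integrable_const _).add hsumint
  have hpath : ∀ ω, wallAtZero p ε n ω ≤ Z n 0 ω + A ω := by
    intro ω
    have hA0 : 0 ≤ A ω := by positivity
    refine hp.wall_le_harness_add hv (fun m j => ε m j ω) n hA0 ?_ n le_rfl 0 (by simp)
    intro m hm i hi
    have h1 : -Z m i ω - lam ≤ Real.exp (-(t * lam)) / t * Real.exp (-(t * Z m i ω)) := by
      rw [div_mul_eq_mul_div, ← Real.exp_add, le_div_iff₀ ht]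
      have := Real.add_one_le_exp (-(t * lam) + -(t * Z m i ω))
      linarith
    have h2 : Real.exp (-(t * lam)) / t * Real.exp (-(t * Z m i ω)) ≤
        ∑ m ∈ Finset.Icc 1 n, ∑ i ∈ box,
          Real.exp (-(t * lam)) / t * Real.exp (-(t * Z m i ω)) := by
      refine le_trans ?_ (Finset.single_le_sum (f := fun m => ∑ i ∈ box,
        Real.exp (-(t * lam)) / t * Real.exp (-(t * Z m i ω))) (fun m _ => by positivity) hm)
      exact Finset.single_le_sum (f := fun i =>
        Real.exp (-(t * lam)) / t * Real.exp (-(t * Z m i ω))) (fun i _ => by positivity) (hmem i hi)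
    have h3 : hp.stepLaw.harness (fun m j => ε m j ω) m i = Z m i ω := rfl
    have h4 : A ω = lam + ∑ m ∈ Finset.Icc 1 n, ∑ i ∈ box,
          Real.exp (-(t * lam)) / t * Real.exp (-(t * Z m i ω)) := rfl
    rw [h3]
    linarith
  have hZint := hε.integrable_harness hp.stepLaw n 0
  calc wallMean P p ε n ≤ ∫ ω, (Z n 0 ω + A ω) ∂P :=
        integral_mono (hε.integrable_wall hp n 0) (hZint.add hAint) hpath
    _ = ∫ ω, A ω ∂P := by
        rw [integral_add hZint hAint, hε.integral_harness, zero_add]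
    _ = lam + ∑ m ∈ Finset.Icc 1 n, ∑ i ∈ box,
          Real.exp (-(t * lam)) / t * ∫ ω, Real.exp (-(t * Z m i ω)) ∂P := by
        rw [hA, integral_add (integrable_const _) hsumint, integral_finsetSum _ fun m hm =>
          integrable_finsetSum _ fun i _ => hterm m hm i]
        congr 1
        · simp
        · refine Finset.sum_congr rfl fun m hm => ?_
          rw [integral_finsetSum _ fun i _ => hterm m hm i]
          simp_rw [integral_const_mul]
    _ ≤ lam + ∑ m ∈ Finset.Icc 1 n, ∑ i ∈ box, Real.exp (-(t * lam)) / t * Real.exp Λ := by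
        gcongr with m hm i _
        exact (h m (Finset.mem_Icc.mp hm).2 i).2
    _ = lam + n * (box.card * (Real.exp (-(t * lam)) * Real.exp Λ)) / t := by
        simp only [Finset.sum_const, Nat.card_Icc, add_tsub_cancel_right, nsmul_eq_mul]
        ring
    _ ≤ lam + n * ((2 * v + 1) ^ d * (n : ℝ) ^ d * (Real.exp (-(t * lam)) * Real.exp Λ)) / t := by
        gcongr
    _ = lam + (2 * v + 1) ^ d / t := by
        have e : Real.exp (-(t * lam)) * Real.exp Λ = ((n : ℝ) ^ (d + 1))⁻¹ := by
          have e1 : -(t * lam) + Λ = -(Real.log ((n : ℝ) ^ (d + 1))) := by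
            rw [hlam, mul_div_cancel₀ _ ht.ne', Real.log_pow]; push_cast; ring
          rw [← Real.exp_add, e1, Real.exp_neg, Real.exp_log (by positivity)]
        rw [e, pow_succ]
        have : (n : ℝ) ≠ 0 := by positivity
        field_simp
    _ = _ := by rw [hlam]; ring

end IsNoise

/-- Upper bound for the mean height of the wall process, with a free parameter `t`. -/
theorem IsHarnessMatrix.exists_wallMean_le.{u} {d : ℕ} {p : (Fin d → ℤ) → (Fin d → ℤ) → ℝ}
    (hp : IsHarnessMatrix p) (hd : 0 < d) {α c c' : ℝ} (hα : 1 ≤ α) (hc : 0 < c) (hc' : 0 < c') :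
    ∃ C A : ℝ, 0 < C ∧ 0 < A ∧
      ∀ (Ω : Type u) [MeasurableSpace Ω] (P : Measure Ω) [IsProbabilityMeasure P]
        (ε : ℕ → (Fin d → ℤ) → Ω → ℝ) (F : Measure ℝ),
        IsNoise P ε F → HasExpTail α c c' F →
        ∀ n : ℕ, 1 ≤ n → ∀ t : ℝ, 0 < t → (t ≤ c' / 2 ∨ 1 < α) →
          wallMean P p ε n ≤ C / t * (Real.log n + 1 + t * ∑ k ∈ Finset.range n,
            growth (1 / (α - 1)) (A * t * (k + 1 : ℝ) ^ (-((d : ℝ) / 2)))) := by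
  obtain ⟨v', hv'⟩ := hp.finite_range
  obtain ⟨v, hv⟩ : ∃ v : ℕ, ∀ j : Fin d → ℤ, (v : ℝ) < ‖j‖ → p 0 j = 0 :=
    ⟨⌈v'⌉₊, fun j hj => hv' j ((Nat.le_ceil v').trans_lt hj)⟩
  obtain ⟨C₀, hC₀, hheat⟩ := hp.exists_coeff_stepLaw_pow_le hd
  obtain ⟨C₁, hC₁, hmgf⟩ := exists_integral_exp_le_exp_growth hα hc hc'
  -- At `α = 1` the quotient is `1 / 0 = 0`, which still keeps `growth` monotone.
  have hβ : 0 ≤ 1 / (α - 1) := one_div_nonneg.mpr (by linarith)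
  set β := 1 / (α - 1)
  refine ⟨d + 1 + C₁ + (2 * v + 1) ^ d, C₀ / (c' / 2), by positivity, by positivity, ?_⟩
  intro Ω _ P _ ε F hε hF n hn t ht hcase
  have := hε.isProbabilityMeasure
  set S := ∑ k ∈ Finset.range n,
    growth β (C₀ / (c' / 2) * t * (k + 1 : ℝ) ^ (-((d : ℝ) / 2))) with hS
  have hgn : ∀ k : ℕ, 0 ≤ growth β (C₀ / (c' / 2) * t * (k + 1 : ℝ) ^ (-((d : ℝ) / 2))) :=
    fun k => growth_nonneg (by positivity)
  have hS0 : 0 ≤ S := Finset.sum_nonneg fun k _ => hgn k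
  set x := hp.stepLaw with hx
  have hnn : ∀ k, (x ^ k).CoeffNonneg := hp.coeffNonneg_stepLaw.pow
  have hmass : ∀ k, (x ^ k).mass = 1 := fun k => by rw [map_pow, hx, hp.mass_stepLaw, one_pow]
  -- Keeps every argument `t p^k(j)` below `c' / 2` when `t` is, as is needed for `α = 1`.
  have hle1 : ∀ k j, (x ^ k).coeff j ≤ 1 := by
    intro k j
    have h := AddMonoidAlgebra.coeff_mul_le (hnn k) (y := 1) (b := 1) (fun m => by
      classical
      rw [AddMonoidAlgebra.one_def, AddMonoidAlgebra.coeff_single, Finsupp.single_apply]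
      split_ifs <;> norm_num) j
    rwa [mul_one, mul_one, hmass] at h
  have hexp : ∀ m ≤ n, ∀ i,
      Integrable (fun ω => Real.exp (-(t * x.harness (fun m j => ε m j ω) m i))) P ∧
      ∫ ω, Real.exp (-(t * x.harness (fun m j => ε m j ω) m i)) ∂P ≤
        Real.exp (C₁ * t * S) := by
    intro m hm i
    have h := hε.integral_exp_harness_le x m i t
      (fun k j => C₁ * (t * (x ^ k).coeff j) * growth β (t * (x ^ k).coeff j / (c' / 2)))
      (fun k _ j => hmgf F hF hε.symmetric _ (mul_nonneg ht.le (hnn k j)) (by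
        refine hcase.imp_left fun h => le_trans ?_ h
        exact mul_le_of_le_one_right ht.le (hle1 k j)))
    refine ⟨h.1, h.2.trans (Real.exp_le_exp.mpr ?_)⟩
    -- The prefactor `p^k(j)` is kept as a probability weight and only the one inside `growth` is
    -- replaced by the heat kernel bound, so the number of sites does not enter.
    calc _ ≤ ∑ k ∈ Finset.range m, C₁ * t *
          growth β (C₀ / (c' / 2) * t * (k + 1 : ℝ) ^ (-((d : ℝ) / 2))) := by
          refine Finset.sum_le_sum fun k _ => ?_
          calc _ ≤ ∑ j ∈ (x ^ k).coeff.support, (x ^ k).coeff j * (C₁ * t *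
                growth β (C₀ / (c' / 2) * t * (k + 1 : ℝ) ^ (-((d : ℝ) / 2)))) := by
                refine Finset.sum_le_sum fun j _ => ?_
                rw [show C₁ * (t * (x ^ k).coeff j) * growth β (t * (x ^ k).coeff j / (c' / 2)) =
                  (x ^ k).coeff j * (C₁ * t * growth β (t * (x ^ k).coeff j / (c' / 2))) by ring]
                refine mul_le_mul_of_nonneg_left (mul_le_mul_of_nonneg_left (growth_mono hβ ?_)
                  (by positivity)) (hnn k j)
                calc t * (x ^ k).coeff j / (c' / 2)
                    ≤ t * (C₀ * (k + 1 : ℝ) ^ (-((d : ℝ) / 2))) / (c' / 2) := by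
                      gcongr
                      exact hheat k j
                  _ = _ := by ring
            _ = _ := by
                rw [← Finset.sum_mul]
                have e := hmass k
                rw [AddMonoidAlgebra.mass_eq_sum, Finsupp.sum] at e
                rw [e, one_mul]
      _ ≤ ∑ k ∈ Finset.range n, C₁ * t *
          growth β (C₀ / (c' / 2) * t * (k + 1 : ℝ) ^ (-((d : ℝ) / 2))) :=
          Finset.sum_le_sum_of_subset_of_nonneg (Finset.range_mono hm)
            fun k _ _ => mul_nonneg (by positivity) (hgn k)
      _ = _ := (Finset.mul_sum _ _ _).symm
  refine (hε.wallMean_le hp hv hn ht (by positivity) hexp).trans ?_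
  rw [div_mul_eq_mul_div]
  gcongr
  have hlog : 0 ≤ Real.log n := Real.log_nonneg (by exact_mod_cast hn)
  have hV : (0 : ℝ) ≤ (2 * v + 1) ^ d := by positivity
  have hd0 : (0 : ℝ) ≤ d := by positivity
  have htS : 0 ≤ t * S := by positivity
  nlinarith [mul_nonneg hV hlog, mul_nonneg hC₁.le hlog, mul_nonneg hV htS, mul_nonneg hd0 htS]

/-! ### Sums of the growth function along the heat kernel decay -/

/-- Telescoping: by concavity of `u^(1-b)` (Bernoulli), each term times `1 - b` is at most an
increment of that power. -/
theorem sum_range_rpow_neg_le {b : ℝ} (hb : 0 ≤ b) (hb1 : b < 1) (n : ℕ) :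
    ∑ k ∈ Finset.range n, (k + 1 : ℝ) ^ (-b) ≤ (n : ℝ) ^ (1 - b) / (1 - b) := by
  have h1b : 0 < 1 - b := by linarith
  induction n with
  | zero => simp [Real.zero_rpow h1b.ne']
  | succ n ih =>
    rw [Finset.sum_range_succ]
    have hpos : (0 : ℝ) < n + 1 := by positivity
    have h1 : (n : ℝ) ^ (1 - b) ≤ (n + 1 : ℝ) ^ (1 - b) - (1 - b) * (n + 1 : ℝ) ^ (-b) := by
      have h2 := rpow_one_add_le_one_add_mul_self (s := -(1 / (n + 1 : ℝ))) (p := 1 - b)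
        (by rw [neg_le_neg_iff, div_le_one hpos]; linarith [(Nat.cast_nonneg n : (0 : ℝ) ≤ n)])
        h1b.le (by linarith)
      have e : (n : ℝ) = (n + 1 : ℝ) * (1 + -(1 / (n + 1 : ℝ))) := by field_simp; ring
      calc (n : ℝ) ^ (1 - b) = (n + 1 : ℝ) ^ (1 - b) * (1 + -(1 / (n + 1 : ℝ))) ^ (1 - b) := by
            rw [← Real.mul_rpow hpos.le, ← e]
            have : 1 / (n + 1 : ℝ) ≤ 1 := by
              rw [div_le_one hpos]; linarith [(Nat.cast_nonneg n : (0 : ℝ) ≤ n)]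
            linarith
        _ ≤ (n + 1 : ℝ) ^ (1 - b) * (1 + (1 - b) * -(1 / (n + 1 : ℝ))) := by gcongr
        _ = _ := by
            rw [show (1 - b) = -b + 1 by ring, Real.rpow_add_one hpos.ne']
            field_simp
            ring
    rw [le_div_iff₀ h1b, add_mul]
    rw [le_div_iff₀ h1b] at ih
    push_cast
    linarith

/-- The convex counterpart; the induction needs the telescoped bound, with the final power of `n`
subtracted. -/
theorem sum_Ico_rpow_neg_le {r : ℝ} (hr : 1 < r) {a : ℕ} (ha : 1 ≤ a) (n : ℕ) :
    ∑ k ∈ Finset.Ico a n, (k + 1 : ℝ) ^ (-r) ≤ (a : ℝ) ^ (1 - r) / (r - 1) := by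
  have hr1 : 0 < r - 1 := by linarith
  rcases le_total n a with h | h
  · rw [Finset.Ico_eq_empty_of_le h, Finset.sum_empty]; positivity
  suffices H : ∑ k ∈ Finset.Ico a n, (k + 1 : ℝ) ^ (-r) ≤
      ((a : ℝ) ^ (1 - r) - (n : ℝ) ^ (1 - r)) / (r - 1) by
    refine H.trans ?_
    gcongr
    have : 0 ≤ (n : ℝ) ^ (1 - r) := by positivity
    linarith
  induction n, h using Nat.le_induction with
  | base => simp
  | succ n hn ih =>
    rw [Finset.sum_Ico_succ_top hn]
    have hnpos : (0 : ℝ) < n := by exact_mod_cast (show 0 < n by omega)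
    have hpos : (0 : ℝ) < n + 1 := by positivity
    have h1 : (n + 1 : ℝ) ^ (1 - r) + (r - 1) * (n + 1 : ℝ) ^ (-r) ≤ (n : ℝ) ^ (1 - r) := by
      have h2 : Real.log ((n : ℝ) / (n + 1)) ≤ -(1 / (n + 1 : ℝ)) := by
        have := Real.log_le_sub_one_of_pos (show 0 < (n : ℝ) / (n + 1) by positivity)
        have e : (n : ℝ) / (n + 1) - 1 = -(1 / (n + 1 : ℝ)) := by field_simp; ring
        linarith
      have h3 : 1 + (r - 1) * (1 / (n + 1 : ℝ)) ≤ ((n : ℝ) / (n + 1)) ^ (1 - r) := by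
        rw [Real.rpow_def_of_pos (by positivity)]
        have := Real.add_one_le_exp (Real.log ((n : ℝ) / (n + 1)) * (1 - r))
        nlinarith
      calc (n + 1 : ℝ) ^ (1 - r) + (r - 1) * (n + 1 : ℝ) ^ (-r)
          = (n + 1 : ℝ) ^ (1 - r) * (1 + (r - 1) * (1 / (n + 1 : ℝ))) := by
            rw [show (1 - r) = -r + 1 by ring, Real.rpow_add_one hpos.ne']
            field_simp
        _ ≤ (n + 1 : ℝ) ^ (1 - r) * ((n : ℝ) / (n + 1)) ^ (1 - r) := by gcongr
        _ = _ := by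
            rw [← Real.mul_rpow hpos.le (by positivity), mul_div_cancel₀ _ hpos.ne']
    rw [le_div_iff₀ hr1, add_mul]
    rw [le_div_iff₀ hr1] at ih
    push_cast
    linarith

theorem sum_range_le_add_sum_Ico {f : ℕ → ℝ} (hf : ∀ k, 0 ≤ f k) (a n : ℕ) :
    ∑ k ∈ Finset.range n, f k ≤ ∑ k ∈ Finset.range a, f k + ∑ k ∈ Finset.Ico a n, f k := by
  rcases le_total n a with h | h
  · have h1 := Finset.sum_le_sum_of_subset_of_nonneg (Finset.range_mono h) fun k _ _ => hf k
    have h2 := Finset.sum_nonneg (s := Finset.Ico a n) fun k _ => hf k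
    linarith
  · rw [Finset.sum_range_add_sum_Ico _ h]

theorem sum_range_rpow_neg_le_of_one_lt {r : ℝ} (hr : 1 < r) (n : ℕ) :
    ∑ k ∈ Finset.range n, (k + 1 : ℝ) ^ (-r) ≤ 1 + 1 / (r - 1) := by
  have h1 := sum_range_le_add_sum_Ico (f := fun k : ℕ => (k + 1 : ℝ) ^ (-r))
    (fun k => by positivity) 1 n
  have h2 := sum_Ico_rpow_neg_le hr le_rfl n
  simp at h1 h2
  simp
  linarith

theorem sum_range_growth_le_of_le_one {β r τ : ℝ} (hr : 0 ≤ r) (hτ1 : τ ≤ 1) (n : ℕ) :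
    ∑ k ∈ Finset.range n, growth β (τ * (k + 1 : ℝ) ^ (-r)) ≤
      ∑ k ∈ Finset.range n, (k + 1 : ℝ) ^ (-r) := by
  refine Finset.sum_le_sum fun k _ => ?_
  have h1 : (k + 1 : ℝ) ^ (-r) ≤ 1 :=
    Real.rpow_le_one_of_one_le_of_nonpos (by linarith [(Nat.cast_nonneg k : (0 : ℝ) ≤ k)])
      (by linarith)
  have h0 : 0 ≤ (k + 1 : ℝ) ^ (-r) := by positivity
  rw [growth_of_le_one (mul_le_one₀ hτ1 h0 h1)]
  exact mul_le_of_le_one_left h0 hτ1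

/-- The regime where the sum is dominated by its first terms. -/
theorem exists_sum_growth_le_of_one_lt_mul {β r : ℝ} (hr : 1 < r) (hβr : 1 < β * r) :
    ∃ C : ℝ, 0 < C ∧ ∀ (n : ℕ) (τ : ℝ), 0 < τ →
      ∑ k ∈ Finset.range n, growth β (τ * (k + 1 : ℝ) ^ (-r)) ≤ C * (1 + τ ^ β) := by
  have hr1 : 0 < r - 1 := by linarith
  have hb1 : 0 < β * r - 1 := by linarith
  refine ⟨1 + 1 / (r - 1) + (1 + 1 / (β * r - 1)), by positivity, fun n τ hτ => ?_⟩
  have h1 := sum_range_rpow_neg_le_of_one_lt hr n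
  have h2 := sum_range_rpow_neg_le_of_one_lt hβr n
  have hs1 : 0 ≤ ∑ k ∈ Finset.range n, (k + 1 : ℝ) ^ (-r) :=
    Finset.sum_nonneg fun k _ => by positivity
  have hs2 : 0 ≤ ∑ k ∈ Finset.range n, (k + 1 : ℝ) ^ (-(β * r)) :=
    Finset.sum_nonneg fun k _ => by positivity
  have hτβ : 0 < τ ^ β := by positivity
  have epow : ∀ k : ℕ, (τ * (k + 1 : ℝ) ^ (-r)) ^ β = τ ^ β * (k + 1 : ℝ) ^ (-(β * r)) := by
    intro k
    rw [Real.mul_rpow hτ.le (by positivity), ← Real.rpow_mul (by positivity)]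
    congr 2; ring
  -- For `β ≤ 1`, `growth β y ≤ y^β`; for `β ≥ 1` it is at most `y + y^β`. Both resulting series
  -- converge.
  rcases le_total β 1 with hβ1 | hβ1
  · calc _ ≤ ∑ k ∈ Finset.range n, τ ^ β * (k + 1 : ℝ) ^ (-(β * r)) := by
          refine Finset.sum_le_sum fun k _ => ?_
          rw [← epow]
          have hy : 0 < τ * (k + 1 : ℝ) ^ (-r) := by positivity
          rcases le_or_gt (τ * (k + 1 : ℝ) ^ (-r)) 1 with h | h
          · rw [growth_of_le_one h]
            simpa using Real.rpow_le_rpow_of_exponent_ge hy h hβ1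
          · rw [growth_of_one_lt h]
      _ = τ ^ β * _ := (Finset.mul_sum _ _ _).symm
      _ ≤ _ := by
          have := mul_le_mul_of_nonneg_left h2 hτβ.le
          have h3 : 0 < 1 / (r - 1) := by positivity
          have h4 : 0 < 1 / (β * r - 1) := by positivity
          nlinarith
  · calc _ ≤ ∑ k ∈ Finset.range n,
          (τ * (k + 1 : ℝ) ^ (-r) + τ ^ β * (k + 1 : ℝ) ^ (-(β * r))) := by
          refine Finset.sum_le_sum fun k _ => ?_
          rw [← epow]
          have hy : 0 < τ * (k + 1 : ℝ) ^ (-r) := by positivity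
          have hy2 : 0 < (τ * (k + 1 : ℝ) ^ (-r)) ^ β := by positivity
          unfold growth
          split_ifs <;> linarith
      _ = τ * ∑ k ∈ Finset.range n, (k + 1 : ℝ) ^ (-r) +
          τ ^ β * ∑ k ∈ Finset.range n, (k + 1 : ℝ) ^ (-(β * r)) := by
          rw [Finset.sum_add_distrib, Finset.mul_sum, Finset.mul_sum]
      _ ≤ (1 + τ ^ β) * (1 + 1 / (r - 1)) + (1 + τ ^ β) * (1 + 1 / (β * r - 1)) := by
          have hτle : τ ≤ 1 + τ ^ β := by
            have := abs_le_one_add_rpow hβ1 τ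
            rwa [abs_of_pos hτ] at this
          gcongr
          linarith
      _ = _ := by ring

/-- The argument `τ (k+1)^(-r)` crosses `1` at `k + 1 = N = τ^(1/r)`. Up to there the power branch
gives the first sum; beyond, the linear branch has a tail of order `τ N^(1-r) = N`. The factor
`2^(r-1)` comes from `⌊N⌋ ≥ N / 2`. -/
theorem sum_growth_le_of_one_lt {β r τ : ℝ} (hr : 1 < r) (hτ : 1 < τ) (n : ℕ) :
    ∑ k ∈ Finset.range n, growth β (τ * (k + 1 : ℝ) ^ (-r)) ≤
      τ ^ β * ∑ k ∈ Finset.range ⌊τ ^ (1 / r)⌋₊, (k + 1 : ℝ) ^ (-(β * r)) +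
        2 ^ (r - 1) / (r - 1) * τ ^ (1 / r) := by
  have hr0 : 0 < r := by linarith
  have hr1 : 0 < r - 1 := by linarith
  have hτ0 : 0 < τ := by linarith
  set N := τ ^ (1 / r) with hN
  have hN1 : 1 ≤ N := Real.one_le_rpow hτ.le (by positivity)
  have hNr : N ^ r = τ := by
    rw [hN, ← Real.rpow_mul hτ0.le, one_div_mul_cancel hr0.ne', Real.rpow_one]
  have hfl : 1 ≤ ⌊N⌋₊ := Nat.one_le_floor_iff _ |>.mpr hN1
  refine (sum_range_le_add_sum_Ico (fun k => growth_nonneg (by positivity)) ⌊N⌋₊ n).trans ?_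
  have hterm : ∀ k : ℕ, τ * (k + 1 : ℝ) ^ (-r) = (N / (k + 1)) ^ r := by
    intro k
    rw [Real.div_rpow (by linarith) (by positivity), hNr, Real.rpow_neg (by positivity),
      div_eq_mul_inv]
  refine add_le_add ?_ ?_
  · rw [Finset.mul_sum]
    refine Finset.sum_le_sum fun k hk => ?_
    have hk1 : ((k + 1 : ℕ) : ℝ) ≤ N :=
      (Nat.le_floor_iff (by linarith)).mp (Finset.mem_range.mp hk)
    push_cast at hk1
    have h1 : 1 ≤ τ * (k + 1 : ℝ) ^ (-r) := by
      rw [hterm]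
      exact Real.one_le_rpow ((one_le_div (by positivity)).mpr hk1) hr0.le
    have e : τ ^ β * (k + 1 : ℝ) ^ (-(β * r)) = (τ * (k + 1 : ℝ) ^ (-r)) ^ β := by
      rw [Real.mul_rpow hτ0.le (by positivity), ← Real.rpow_mul (by positivity)]
      congr 2; ring
    rw [e]
    rcases h1.eq_or_lt with h | h
    · rw [← h, growth_of_le_one le_rfl, Real.one_rpow]
    · rw [growth_of_one_lt h]
  · calc _ ≤ ∑ k ∈ Finset.Ico ⌊N⌋₊ n, τ * (k + 1 : ℝ) ^ (-r) := by
          refine Finset.sum_le_sum fun k hk => ?_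
          have hk1 : N < k + 1 := by
            have h := Nat.lt_floor_add_one N
            have : (⌊N⌋₊ : ℝ) ≤ k := by exact_mod_cast (Finset.mem_Ico.mp hk).1
            linarith
          rw [growth_of_le_one]
          rw [hterm]
          exact Real.rpow_le_one (by positivity) ((div_le_one (by positivity)).mpr hk1.le) hr0.le
      _ = τ * _ := (Finset.mul_sum _ _ _).symm
      _ ≤ τ * ((⌊N⌋₊ : ℝ) ^ (1 - r) / (r - 1)) := by
          gcongr
          exact sum_Ico_rpow_neg_le hr hfl n
      _ ≤ τ * ((N / 2) ^ (1 - r) / (r - 1)) := by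
          gcongr τ * (?_ / _)
          refine Real.rpow_le_rpow_of_nonpos (by positivity) ?_ (by linarith)
          have h := Nat.lt_floor_add_one N
          have : (1 : ℝ) ≤ ⌊N⌋₊ := by exact_mod_cast hfl
          linarith
      _ = _ := by
          rw [Real.div_rpow (by linarith) (by norm_num), show (1 - r) = -(r - 1) by ring,
            Real.rpow_neg (by norm_num : (0 : ℝ) ≤ 2), div_inv_eq_mul]
          have e : τ * N ^ (-(r - 1)) = N := by
            nth_rewrite 1 [← hNr]
            rw [← Real.rpow_add (by linarith), show r + -(r - 1) = 1 by ring, Real.rpow_one]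
          calc _ = τ * N ^ (-(r - 1)) * 2 ^ (r - 1) / (r - 1) := by ring
            _ = _ := by rw [e]; ring

/-- The regime where the sum is dominated by the terms of order one. -/
theorem exists_sum_growth_le_of_mul_lt_one {β r : ℝ} (hβ : 0 < β) (hr : 1 < r) (hβr : β * r < 1) :
    ∃ C : ℝ, 0 < C ∧ ∀ (n : ℕ) (τ : ℝ), 0 < τ →
      ∑ k ∈ Finset.range n, growth β (τ * (k + 1 : ℝ) ^ (-r)) ≤ C * (1 + τ ^ (1 / r)) := by
  have hr0 : 0 < r := by linarith
  have hr1 : 0 < r - 1 := by linarith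
  have hb1 : 0 < 1 - β * r := by linarith
  refine ⟨1 + 1 / (r - 1) + 1 / (1 - β * r) + 2 ^ (r - 1) / (r - 1), by positivity,
    fun n τ hτ => ?_⟩
  have p1 : 0 < 1 / (r - 1) := by positivity
  have p2 : 0 < 1 / (1 - β * r) := by positivity
  have p3 : 0 < 2 ^ (r - 1) / (r - 1) := by positivity
  have hN0 : 0 < τ ^ (1 / r) := by positivity
  rcases le_or_gt τ 1 with h | h
  · refine ((sum_range_growth_le_of_le_one hr0.le h n).trans
      (sum_range_rpow_neg_le_of_one_lt hr n)).trans ?_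
    nlinarith
  · refine (sum_growth_le_of_one_lt hr h n).trans ?_
    -- With `N = τ^(1/r)`, the block is of order `τ^β N^(1-βr) = N`, the same as the tail.
    have h1 : τ ^ β * ∑ k ∈ Finset.range ⌊τ ^ (1 / r)⌋₊, (k + 1 : ℝ) ^ (-(β * r)) ≤
        1 / (1 - β * r) * τ ^ (1 / r) := by
      calc _ ≤ τ ^ β * ((⌊τ ^ (1 / r)⌋₊ : ℝ) ^ (1 - β * r) / (1 - β * r)) := by
            gcongr
            exact sum_range_rpow_neg_le (by positivity) hβr _
        _ ≤ τ ^ β * ((τ ^ (1 / r)) ^ (1 - β * r) / (1 - β * r)) := by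
            gcongr
            exact Nat.floor_le hN0.le
        _ = _ := by
            rw [← Real.rpow_mul hτ.le, ← mul_div_assoc, ← Real.rpow_add hτ,
              show β + 1 / r * (1 - β * r) = 1 / r by field_simp; ring]
            ring
    nlinarith

/-- The critical regime. -/
theorem exists_sum_growth_le_of_mul_eq_one {β r : ℝ} (hr : 1 < r) (hβr : β * r = 1) :
    ∃ C : ℝ, 0 < C ∧ ∀ (n : ℕ) (τ : ℝ), 0 < τ →
      ∑ k ∈ Finset.range n, growth β (τ * (k + 1 : ℝ) ^ (-r)) ≤
        C * (1 + τ ^ (1 / r) * (1 + Real.log (1 + τ))) := by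
  have hr0 : 0 < r := by linarith
  have hr1 : 0 < r - 1 := by linarith
  have hβ : β = 1 / r := by field_simp; linarith
  refine ⟨1 + 1 / (r - 1) + 1 + 2 ^ (r - 1) / (r - 1), by positivity, fun n τ hτ => ?_⟩
  have p1 : 0 < 1 / (r - 1) := by positivity
  have p3 : 0 < 2 ^ (r - 1) / (r - 1) := by positivity
  have hN0 : 0 < τ ^ (1 / r) := by positivity
  have hlog : 0 ≤ Real.log (1 + τ) := Real.log_nonneg (by linarith)
  have hNl : 0 ≤ τ ^ (1 / r) * Real.log (1 + τ) := by positivity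
  rcases le_or_gt τ 1 with h | h
  · refine ((sum_range_growth_le_of_le_one hr0.le h n).trans
      (sum_range_rpow_neg_le_of_one_lt hr n)).trans ?_
    nlinarith
  · refine (sum_growth_le_of_one_lt hr h n).trans ?_
    -- At `βr = 1` the block is a harmonic sum, the source of the logarithm.
    have h1 : ∑ k ∈ Finset.range ⌊τ ^ (1 / r)⌋₊, (k + 1 : ℝ) ^ (-(β * r)) ≤
        1 + Real.log (1 + τ) := by
      have h2 := harmonic_floor_le_one_add_log (τ ^ (1 / r)) (Real.one_le_rpow h.le (by positivity))
      have h3 : ∑ k ∈ Finset.range ⌊τ ^ (1 / r)⌋₊, (k + 1 : ℝ) ^ (-(β * r)) =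
          (harmonic ⌊τ ^ (1 / r)⌋₊ : ℚ) := by
        rw [harmonic]
        push_cast
        refine Finset.sum_congr rfl fun k _ => ?_
        rw [hβr, Real.rpow_neg_one]
      rw [h3]
      refine h2.trans ?_
      rw [Real.log_rpow hτ]
      have h4 : Real.log τ ≤ Real.log (1 + τ) := Real.log_le_log hτ (by linarith)
      have h5 : 0 ≤ Real.log τ := Real.log_nonneg h.le
      have h6 : 1 / r ≤ 1 := (div_le_one hr0).mpr hr.le
      nlinarith
    have h7 := mul_le_mul_of_nonneg_left h1 hN0.le
    rw [← hβ] at h7 hN0 hNl ⊢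
    nlinarith

/-! ### Choice of the parameter `t` -/

theorem theorem4 (d : ℕ) (p : (Fin d → ℤ) → (Fin d → ℤ) → ℝ) (hp : IsHarnessMatrix p)
    (α c c' : ℝ) (hα : 1 ≤ α) (hc : 0 < c) (hc' : 0 < c') :
    (3 ≤ d → ∃ c₃ : ℝ, 0 < c₃ ∧
      ∀ (Ω : Type*) [MeasurableSpace Ω] (P : Measure Ω) [IsProbabilityMeasure P]
        (ε : ℕ → (Fin d → ℤ) → Ω → ℝ) (F : Measure ℝ),
        IsNoise P ε F → HasExpTail α c c' F →
        ∀ n : ℕ, 2 ≤ n → Integrable (wallAtZero p ε n) P ∧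
          (α ≠ 1 + (d : ℝ) / 2 →
            wallMean P p ε n ≤ c₃ * Real.log n ^ max (1 / α) (2 / (2 + (d : ℝ)))) ∧
          (α = 1 + (d : ℝ) / 2 →
            wallMean P p ε n ≤ c₃ * bigL n (1 + 2 / (d : ℝ)))) ∧
    (d = 2 → ∃ c₃ : ℝ, 0 < c₃ ∧
      ∀ (Ω : Type*) [MeasurableSpace Ω] (P : Measure Ω) [IsProbabilityMeasure P]
        (ε : ℕ → (Fin d → ℤ) → Ω → ℝ) (F : Measure ℝ),
        IsNoise P ε F → HasExpTail α c c' F →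
        ∀ n : ℕ, 2 ≤ n → Integrable (wallAtZero p ε n) P ∧
          wallMean P p ε n ≤ c₃ * Real.log n) := by
  have hlog2 : 0 < Real.log 2 := Real.log_pos (by norm_num)
  -- For `n ≥ 2` additive constants are absorbed into multiples of `log n`.
  have hlogn : ∀ n : ℕ, 2 ≤ n → 0 < Real.log n ∧ 1 ≤ 1 / Real.log 2 * Real.log n := by
    intro n hn
    have h1 : Real.log 2 ≤ Real.log n := Real.log_le_log (by norm_num) (by exact_mod_cast hn)
    refine ⟨by linarith, ?_⟩
    rw [div_mul_eq_mul_div, one_mul]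
    exact (one_le_div hlog2).mpr h1
  have hK : 0 < 1 / Real.log 2 := by positivity
  set K := 1 / Real.log 2
  constructor
  · intro hd
    have hd3 : (3 : ℝ) ≤ d := by exact_mod_cast hd
    obtain ⟨C, A, hC, hA, hmain⟩ := hp.exists_wallMean_le (by omega) hα hc hc'
    set r : ℝ := d / 2 with hr
    have hr1 : 1 < r := by rw [hr]; linarith
    have hr0 : 0 < r := by linarith
    have hinv : 2 / (2 + (d : ℝ)) = 1 / (1 + r) := by rw [hr]; field_simp
    have hinv2 : 1 + 2 / (d : ℝ) = 1 + 1 / r := by rw [hr]; field_simp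
    rw [hinv, hinv2]
    rcases hα.eq_or_lt with rfl | hα1
    · -- exponential tails: `t` is a constant
      -- The first bound makes `t` admissible for `α = 1`; the second keeps all arguments of
      -- `growth` at most `1`, where it is linear and the sum is bounded.
      set t := min (c' / 2) (1 / A) with ht
      have ht0 : 0 < t := lt_min (by positivity) (by positivity)
      refine ⟨C / t * (1 + K + t * (1 + 1 / (r - 1)) * K),
        by have : 0 < r - 1 := by linarith
           positivity, ?_⟩
      intro Ω _ P _ ε F hε hF n hn
      refine ⟨hε.integrable_wall hp n 0, fun _ => ?_, fun h => by linarith⟩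
      have hb := hmain Ω P ε F hε hF n (by omega) t ht0 (Or.inl (min_le_left _ _))
      obtain ⟨hl, hl1⟩ := hlogn n hn
      rw [max_eq_left (by
        rw [div_one]; exact (div_le_one (by linarith)).mpr (by linarith)), div_one, Real.rpow_one]
      have hAt : A * t ≤ 1 := by
        calc A * t ≤ A * (1 / A) := by gcongr; exact min_le_right _ _
          _ = 1 := by field_simp
      have hS := (sum_range_growth_le_of_le_one (β := 1 / ((1 : ℝ) - 1)) hr0.le hAt n).trans
        (sum_range_rpow_neg_le_of_one_lt hr1 n)
      refine hb.trans ?_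
      rw [mul_assoc]
      gcongr
      have h1 := mul_le_mul_of_nonneg_left hS ht0.le
      have h2 : 0 < t * (1 + 1 / (r - 1)) := by
        have : 0 < r - 1 := by linarith
        positivity
      have h3 := mul_le_mul_of_nonneg_left hl1 h2.le
      linarith
    have hα0 : 0 < α - 1 := by linarith
    set β := 1 / (α - 1) with hβ
    have hβ0 : 0 < β := by rw [hβ]; positivity
    have hαβ : 1 / α = 1 - 1 / (1 + 1 / (α - 1)) := by field_simp; ring
    -- a power bound on the sum yields the optimal choice of `t`
    have hpower : ∀ b D : ℝ, 0 < b → 0 < D →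
        (∀ (n : ℕ) (τ : ℝ), 0 < τ →
          ∑ k ∈ Finset.range n, growth β (τ * (k + 1 : ℝ) ^ (-r)) ≤ D * (1 + τ ^ b)) →
        ∃ c₃ : ℝ, 0 < c₃ ∧ ∀ (Ω : Type _) [MeasurableSpace Ω] (P : Measure Ω)
          [IsProbabilityMeasure P] (ε : ℕ → (Fin d → ℤ) → Ω → ℝ) (F : Measure ℝ),
          IsNoise P ε F → HasExpTail α c c' F → ∀ n : ℕ, 2 ≤ n →
            wallMean P p ε n ≤ c₃ * Real.log n ^ (1 - 1 / (1 + b)) := by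
      intro b D hb hD hsum
      refine ⟨C * (1 + K + D * (K + 1 + A ^ b)), by positivity, ?_⟩
      intro Ω _ P _ ε F hε hF n hn
      obtain ⟨hl, hl1⟩ := hlogn n hn
      -- Here `t^(1+b) = log n`, which balances the noise cost with the entropy term, so the bound
      -- is of order `log n / t`.
      set t := Real.log n ^ (1 / (1 + b)) with ht
      have ht0 : 0 < t := by positivity
      have htb : t ^ (1 + b) = Real.log n := by
        rw [ht, ← Real.rpow_mul hl.le, one_div_mul_cancel (by positivity), Real.rpow_one]
      have h := hmain Ω P ε F hε hF n (by omega) t ht0 (Or.inr hα1)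
      have h1 := hsum n (A * t) (by positivity)
      rw [Real.mul_rpow hA.le ht0.le] at h1
      have h2 : t ≤ 1 + t ^ (1 + b) := by
        have := abs_le_one_add_rpow (show 1 ≤ 1 + b by linarith) t
        rwa [abs_of_pos ht0] at this
      have h3 : t * (t ^ b) = Real.log n := by rw [← htb, Real.rpow_add ht0, Real.rpow_one]
      have h4 : t * ∑ k ∈ Finset.range n, growth β (A * t * (k + 1 : ℝ) ^ (-r)) ≤
          D * (K + 1 + A ^ b) * Real.log n := by
        calc _ ≤ t * (D * (1 + A ^ b * t ^ b)) := mul_le_mul_of_nonneg_left h1 ht0.le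
          _ = D * (t + A ^ b * (t * t ^ b)) := by ring
          _ ≤ D * ((K + 1) * Real.log n + A ^ b * Real.log n) := by
              rw [h3]
              gcongr
              linarith
          _ = _ := by ring
      calc wallMean P p ε n ≤ C / t * _ := h
        _ ≤ C / t * ((1 + K + D * (K + 1 + A ^ b)) * Real.log n) := by
            gcongr
            linarith
        _ = _ := by
            rw [Real.rpow_sub hl, Real.rpow_one, ← ht]
            ring
    -- Comparing `α` with `1 + r` amounts to comparing `1` with `β r`.
    rcases lt_trichotomy α (1 + r) with hlt | heq | hgt
    · have hβr : 1 < β * r := by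
        rw [hβ, div_mul_eq_mul_div, one_mul, one_lt_div hα0]; linarith
      obtain ⟨D, hD, hsum⟩ := exists_sum_growth_le_of_one_lt_mul hr1 hβr
      obtain ⟨c₃, hc₃, h⟩ := hpower β D hβ0 hD hsum
      refine ⟨c₃, hc₃, fun Ω _ P _ ε F hε hF n hn =>
        ⟨hε.integrable_wall hp n 0, fun _ => ?_, fun h => absurd h hlt.ne⟩⟩
      rw [max_eq_left (one_div_le_one_div_of_le (by linarith) hlt.le), hαβ]
      exact h Ω P ε F hε hF n hn
    · have hβr : β * r = 1 := by
        rw [hβ, heq, add_sub_cancel_left, one_div_mul_cancel hr0.ne']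
      obtain ⟨D, hD, hsum⟩ := exists_sum_growth_le_of_mul_eq_one hr1 hβr
      have hlA : 0 < Real.log (1 + A) := Real.log_pos (by linarith)
      set γ := 1 + 1 / r with hγ
      have hγ1 : 1 < γ := by rw [hγ]; linarith [one_div_pos.mpr hr0]
      refine ⟨C * (1 + K + (D * (1 + A ^ (1 / r) * (1 + Real.log (1 + A))) *
        (Real.exp γ * K + 1) + D * A ^ (1 / r))), by positivity, ?_⟩
      intro Ω _ P _ ε F hε hF n hn
      refine ⟨hε.integrable_wall hp n 0, fun h => absurd heq h, fun _ => ?_⟩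
      obtain ⟨hl, hl1⟩ := hlogn n hn
      obtain ⟨ht0, hell⟩ := ell_spec hγ1 (show 1 ≤ n by omega)
      rw [bigL]
      set t := ell n γ with ht
      have hlt : 0 < Real.log t := by
        rw [← hell] at hl
        exact pos_of_mul_pos_right hl (by positivity)
      have ht1 : 1 < t := (Real.log_pos_iff ht0.le).mp hlt
      have h := hmain Ω P ε F hε hF n (by omega) t ht0 (Or.inr hα1)
      have h1 := hsum n (A * t) (by positivity)
      rw [Real.mul_rpow hA.le ht0.le] at h1
      have h2 : t * t ^ (1 / r) = t ^ γ := by rw [hγ, Real.rpow_add ht0, Real.rpow_one]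
      have h3 : Real.log (1 + A * t) ≤ Real.log (1 + A) + Real.log t := by
        rw [← Real.log_mul (by positivity) (by positivity)]
        exact Real.log_le_log (by positivity) (by nlinarith)
      have h4 : t ≤ t ^ γ := Real.self_le_rpow_of_one_le ht1.le hγ1.le
      -- If `log t ≥ 1` the equation for `t = ℓ_n(γ)` gives `t^γ ≤ log n`; otherwise `t ≤ e`, and
      -- the constant `e^γ` is absorbed through `K`.
      have h5 : t ^ γ ≤ (Real.exp γ * K + 1) * Real.log n := by
        rcases le_total (Real.log t) 1 with h | h
        · have : t ^ γ ≤ Real.exp γ := by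
            rw [Real.rpow_def_of_pos ht0, Real.exp_le_exp]
            exact mul_le_of_le_one_left (by linarith) h
          have h6 := mul_le_mul_of_nonneg_left hl1 (Real.exp_pos γ).le
          nlinarith
        · have : t ^ γ ≤ Real.log n := by
            rw [← hell]
            exact le_mul_of_one_le_right (by positivity) h
          have : 0 ≤ Real.exp γ * K * Real.log n := by positivity
          linarith
      have h6 : t * ∑ k ∈ Finset.range n, growth β (A * t * (k + 1 : ℝ) ^ (-r)) ≤
          (D * (1 + A ^ (1 / r) * (1 + Real.log (1 + A))) * (Real.exp γ * K + 1) +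
            D * A ^ (1 / r)) * Real.log n := by
        calc _ ≤ t * (D * (1 + A ^ (1 / r) * t ^ (1 / r) * (1 + Real.log (1 + A * t)))) :=
              mul_le_mul_of_nonneg_left h1 ht0.le
          _ ≤ t * (D * (1 + A ^ (1 / r) * t ^ (1 / r) *
              (1 + (Real.log (1 + A) + Real.log t)))) := by gcongr
          _ = D * (t + A ^ (1 / r) * (1 + Real.log (1 + A)) * (t * t ^ (1 / r))) +
              D * A ^ (1 / r) * (t * t ^ (1 / r) * Real.log t) := by ring
          _ ≤ D * (t ^ γ + A ^ (1 / r) * (1 + Real.log (1 + A)) * t ^ γ) +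
              D * A ^ (1 / r) * Real.log n := by
              rw [h2, hell]
              gcongr
          _ = D * (1 + A ^ (1 / r) * (1 + Real.log (1 + A))) * t ^ γ +
              D * A ^ (1 / r) * Real.log n := by ring
          _ ≤ D * (1 + A ^ (1 / r) * (1 + Real.log (1 + A))) *
              ((Real.exp γ * K + 1) * Real.log n) + D * A ^ (1 / r) * Real.log n := by gcongr
          _ = _ := by ring
      refine h.trans ?_
      rw [div_mul_eq_mul_div, ← mul_div_assoc, mul_assoc C]
      gcongr
      linarith
    · have hβr : β * r < 1 := by
        rw [hβ, div_mul_eq_mul_div, one_mul, div_lt_one hα0]; linarith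
      obtain ⟨D, hD, hsum⟩ := exists_sum_growth_le_of_mul_lt_one hβ0 hr1 hβr
      obtain ⟨c₃, hc₃, h⟩ := hpower (1 / r) D (by positivity) hD hsum
      refine ⟨c₃, hc₃, fun Ω _ P _ ε F hε hF n hn =>
        ⟨hε.integrable_wall hp n 0, fun _ => ?_, fun h => absurd h hgt.ne'⟩⟩
      rw [max_eq_right (one_div_le_one_div_of_le (by linarith) hgt.le),
        show 1 / (1 + r) = 1 - 1 / (1 + 1 / r) by field_simp; ring]
      exact h Ω P ε F hε hF n hn
  · intro hd
    have hd2 : (d : ℝ) / 2 = 1 := by rw [hd]; norm_num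
    obtain ⟨C, A, hC, hA, hmain⟩ := hp.exists_wallMean_le (by omega) hα hc hc'
    set t := min (c' / 2) (1 / A) with ht
    have ht0 : 0 < t := lt_min (by positivity) (by positivity)
    refine ⟨C / t * (1 + K + t * (K + 1)), by positivity, ?_⟩
    intro Ω _ P _ ε F hε hF n hn
    refine ⟨hε.integrable_wall hp n 0, ?_⟩
    have hb := hmain Ω P ε F hε hF n (by omega) t ht0 (Or.inl (min_le_left _ _))
    obtain ⟨hl, hl1⟩ := hlogn n hn
    have hAt : A * t ≤ 1 := by
      calc A * t ≤ A * (1 / A) := by gcongr; exact min_le_right _ _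
        _ = 1 := by field_simp
    rw [hd2] at hb
    -- For `d = 2` the heat kernel decays like `1/(k+1)`, so even with constant `t` the sum is of
    -- order `log n`, the same as the entropy term.
    have hharm : ∑ k ∈ Finset.range n, (k + 1 : ℝ) ^ (-(1 : ℝ)) ≤ 1 + Real.log n := by
      refine le_trans (le_of_eq ?_) (harmonic_le_one_add_log n)
      rw [harmonic]
      push_cast
      exact Finset.sum_congr rfl fun k _ => Real.rpow_neg_one _
    have hS := (sum_range_growth_le_of_le_one (β := 1 / (α - 1)) zero_le_one hAt n).trans hharm
    refine hb.trans ?_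
    rw [mul_assoc]
    gcongr
    have h1 := mul_le_mul_of_nonneg_left hS ht0.le
    have h2 := mul_le_mul_of_nonneg_left hl1 ht0.le
    linarith
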